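/- **Setting.** Let $\Theta\subseteq\mathbb R^d$ be measurable and let $\{P_\alpha:\alpha\in\Theta\}$ be probability measures on a measurable space $\mathcal X$ with jointly measurable, strictly positive densities $p_\alpha(x)$ with respect to a $\sigma$-finite measure $\lambda$ ($\mathcal X$ is the common support). Let $\phi$ be a nonnegative function, $C^2$ and strictly convex on $(0,\infty)$, with $\phi(1)=0$. Fix $\theta_0\in\Theta$ (the true parameter) and $\theta\in\Theta$ (the escort parameter). Put $D_\phi(P_\theta,P_\alpha)=\int\phi(p_\theta/p_\alpha)\,dP_\alpha\in[0,\infty]$ and $\mathcal U=\{\alpha\in\Theta: D_\phi(P_\theta,P_\alpha)<\infty\}$; assume $\int|\phi'(p_\theta/p_\alpha)|\,p_\theta\,d\lambda<\infty$ for $\alpha\in\mathcal U$, and put $$h(\theta,\alpha,x)=\int\phi'\Big(\frac{p_\theta}{p_\alpha}\Big)p_\theta\,d\lambda-\Big[\frac{p_\theta(x)}{p_\alpha(x)}\phi'\Big(\frac{p_\theta(x)}{p_\alpha(x)}\Big)-\phi\Big(\frac{p_\theta(x)}{p_\alpha(x)}\Big)\Big].$$ Assume that $\theta_0$ is identifiable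 in the sense that for every $\delta>0$ the distance $\int|p_\alpha-p_{\theta_0}|\,d\lambda$ is bounded away from $0$ over $\alpha\in\mathcal U$ with $|\alpha-\theta_0|\ge\delta$. Let $X_1,X_2,\dots$ be i.i.d. with law $P_{\theta_0}$. For a function $f$ on $\mathcal X$ write $\mathbb P_nf=\frac1n\sum_{i\le n}f(X_i)$ and $P_{\theta_0}f=\int f\,dP_{\theta_0}$. Let $$S=-P_{\theta_0}\frac{\partial^2}{\partial\alpha^2}h(\theta,\theta_0),\qquad V=P_{\theta_0}\Big[\frac{\partial}{\partial\alpha}h(\theta,\theta_0)\,\frac{\partial}{\partial\alpha}h(\theta,\theta_0)^\top\Big],\qquad U_n(\theta_0)=\mathbb P_n\frac{\partial}{\partial\alpha}h(\theta,\theta_0),$$ and let $R_n(\alpha)$ be defined by $$\mathbb P_nh(\theta,\alpha)-\mathbb P_nh(\theta,\theta_0)=(\alpha-\theta_0)^\top U_n(\theta_0)-\tfrac12(\alpha-\theta_0)^\top S(\alpha-\theta_0)+R_n(\alpha).$$ **Conditions.** (R.1) $h(\theta,\alpha)$ is $P_{\theta_0}$-integrable for $\alpha\in\mathcal U$ and $\sup_{\alpha\in\mathcal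 U}|\mathbb P_nh(\theta,\alpha)-P_{\theta_0}h(\theta,\alpha)|\to0$ almost surely. (R.2) On some open neighbourhood $N\subseteq\mathcal U$ of $\theta_0$, for almost every $x$: the first and second order partial derivatives in $\alpha$ of $\phi'(p_\theta(x)/p_\alpha(x))\,p_\theta(x)$ exist and are dominated by a $\lambda$-integrable function of $x$; the partial derivatives of $h(\theta,\alpha,x)$ in $\alpha$ up to order three exist, and those of order three are dominated by a $P_{\theta_0}$-integrable function of $x$. (R.3) The first order partial derivatives of $h(\theta,\cdot,x)$ at $\theta_0$ are square integrable and those of the second order are integrable under $P_{\theta_0}$ (so that $S$ and $V$ exist), and $S$ and $V$ are nonsingular. (R.4) For every $\epsilon>0$ there is $\delta>0$ such that the probability of the event $\sup_{|\alpha-\theta_0|\le\delta}|R_n(\alpha)|\ge\epsilon$ tends to $0$ as $n\to\infty$. **Theorem 1.** Let $\pi\ge0$ be an integrable prior on $\Theta$ with $\int_\Theta|\alpha|\,\pi(\alpha)\,d\alpha<\infty$, continuous and positive at $\theta_0$, and let (R.1)–(R.4) hold. Let $$p_{\phi,n}(\alpha)=\frac{\exp\{n\mathbb P_nh(\theta,\alpha)\}\,\pi(\alpha)}{\int_{\mathcal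 U}\exp\{n\mathbb P_nh(\theta,\beta)\}\,\pi(\beta)\,d\beta}\quad(\alpha\in\mathcal U),\qquad p_{\phi,n}(\alpha)=0\quad(\alpha\notin\mathcal U)$$ be the $\phi$-posterior density, $\Delta_n=\theta_0+S^{-1}U_n(\theta_0)$, and let $p^*_{\phi,n}(t)=n^{-d/2}\,p_{\phi,n}(\Delta_n+t/\sqrt n)$ be the $\phi$-posterior density of $t=\sqrt n(\alpha-\Delta_n)$. Then $$\int_{\mathbb R^d}\Big|p^*_{\phi,n}(t)-\sqrt{\frac{\det S}{(2\pi)^d}}\,\exp\{-\tfrac12t^\top St\}\Big|\,dt\longrightarrow0\quad\text{in probability.}$$ -/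

import Mathlib

open MeasureTheory ProbabilityTheory Filter Topology Set
open scoped ENNReal Matrix

noncomputable section

namespace PhiPosterior

/-- The ambient parameter space `ℝ^d` with its Euclidean norm. -/
abbrev Param (d : ℕ) := EuclideanSpace ℝ (Fin d)

/-- A parametric model `{P_α : α ∈ Θ}` with `Θ ⊆ ℝ^d`, dominated by a `σ`-finite measure. The
observation space is the common support of the densities, so that all the ratios
`p_θ(x) / p_α(x)` lie in `(0, ∞)`. -/
structure Model (d : ℕ) (𝒳 : Type*) [MeasurableSpace 𝒳] where
  /-- the parameter set `Θ` -/
  Θ : Set (Param d)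
  /-- the dominating measure -/
  dom : Measure 𝒳
  /-- the densities `p_α(x)`; only their values for `α ∈ Θ` matter -/
  p : Param d → 𝒳 → ℝ
  measurableSet_Θ : MeasurableSet Θ
  sigmaFinite_dom : SigmaFinite dom
  measurable_p : Measurable (Function.uncurry p)
  p_pos : ∀ α ∈ Θ, ∀ x, 0 < p α x
  lintegral_p : ∀ α ∈ Θ, ∫⁻ x, ENNReal.ofReal (p α x) ∂dom = 1

/-- The convex functions generating the divergences: finite, nonnegative, `C²` and strictly convex
on `(0, ∞)`, with value `0` at `1`. -/
structure IsDivergenceGenerator (φ : ℝ → ℝ) : Prop where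
  contDiffOn : ContDiffOn ℝ 2 φ (Ioi 0)
  strictConvexOn : StrictConvexOn ℝ (Ioi 0) φ
  nonneg : ∀ u, 0 < u → 0 ≤ φ u
  map_one : φ 1 = 0

section Model

variable {d : ℕ} {𝒳 : Type*} [MeasurableSpace 𝒳]

/-- The probability measure `P_α`. -/
def Model.law (M : Model d 𝒳) (α : Param d) : Measure 𝒳 :=
  M.dom.withDensity fun x => ENNReal.ofReal (M.p α x)

/-- The likelihood ratio `p_θ(x) / p_α(x)`. -/
def Model.ratio (M : Model d 𝒳) (θ α : Param d) (x : 𝒳) : ℝ := M.p θ x / M.p α x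

/-- The divergence `D_φ(P_θ, P_α) = ∫ φ(p_θ / p_α) dP_α`, with values in `[0, ∞]`. -/
def divergence (φ : ℝ → ℝ) (M : Model d 𝒳) (θ α : Param d) : ℝ≥0∞ :=
  ∫⁻ x, ENNReal.ofReal (φ (M.ratio θ α x)) ∂(M.law α)

/-- The set `𝒰` of the `α ∈ Θ` at finite divergence, for the fixed escort parameter `θ`. -/
def finiteSet (φ : ℝ → ℝ) (M : Model d 𝒳) (θ : Param d) : Set (Param d) :=
  {α | α ∈ M.Θ ∧ divergence φ M θ α < ∞}

/-- The function `φ'(p_θ(x) / p_α(x)) p_θ(x)`. -/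
def dualIntegrand (φ : ℝ → ℝ) (M : Model d 𝒳) (θ α : Param d) (x : 𝒳) : ℝ :=
  deriv φ (M.ratio θ α x) * M.p θ x

/-- The function `h(θ, α, x)` of the dual form of the divergence. -/
def h (φ : ℝ → ℝ) (M : Model d 𝒳) (θ α : Param d) (x : 𝒳) : ℝ :=
  (∫ y, dualIntegrand φ M θ α y ∂M.dom) -
    (M.ratio θ α x * deriv φ (M.ratio θ α x) - φ (M.ratio θ α x))

/-- The parameters away from `θ₀` have laws away from `P_{θ₀}`: for every `δ > 0`, the `L¹` distance
of the densities is bounded away from `0` over the `α ∈ 𝒰` with `|α - θ₀| ≥ δ`. -/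
def SeparatedFrom (φ : ℝ → ℝ) (M : Model d 𝒳) (θ θ₀ : Param d) : Prop :=
  ∀ δ : ℝ, 0 < δ → ∃ η : ℝ, 0 < η ∧ ∀ α ∈ finiteSet φ M θ, δ ≤ ‖α - θ₀‖ →
    η ≤ ∫ x, |M.p α x - M.p θ₀ x| ∂M.dom

/-- The `i`-th partial derivative of a function on `ℝ^d`. -/
def pd (i : Fin d) (f : Param d → ℝ) : Param d → ℝ :=
  fun α => lineDeriv ℝ f α (EuclideanSpace.single i 1)

/-- All the partial derivatives of `f` of order at most `k` exist on `N`. -/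
def HasPartialsOn : ℕ → (Param d → ℝ) → Set (Param d) → Prop
  | 0, _, _ => True
  | k + 1, f, N => ∀ i : Fin d,
      (∀ α ∈ N, LineDifferentiableAt ℝ f α (EuclideanSpace.single i 1)) ∧
        HasPartialsOn k (pd i f) N

/-- The gradient `∂h(θ, α, x)/∂α` at `α`. -/
def gradH (φ : ℝ → ℝ) (M : Model d 𝒳) (θ α : Param d) (x : 𝒳) : Fin d → ℝ :=
  fun i => pd i (fun β => h φ M θ β x) α

/-- The matrix `∂²h(θ, α, x)/∂α²` at `α`. -/
def hessH (φ : ℝ → ℝ) (M : Model d 𝒳) (θ α : Param d) (x : 𝒳) : Matrix (Fin d) (Fin d) ℝ :=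
  Matrix.of fun i j => pd i (pd j fun β => h φ M θ β x) α

/-- `S = -P_{θ₀} ∂²h(θ, θ₀)/∂α²`. -/
def matS (φ : ℝ → ℝ) (M : Model d 𝒳) (θ θ₀ : Param d) : Matrix (Fin d) (Fin d) ℝ :=
  Matrix.of fun i j => -∫ x, hessH φ M θ θ₀ x i j ∂(M.law θ₀)

/-- `V = P_{θ₀} (∂h(θ, θ₀)/∂α) (∂h(θ, θ₀)/∂α)ᵀ`. -/
def matV (φ : ℝ → ℝ) (M : Model d 𝒳) (θ θ₀ : Param d) : Matrix (Fin d) (Fin d) ℝ :=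
  Matrix.of fun i j => ∫ x, gradH φ M θ θ₀ x i * gradH φ M θ θ₀ x j ∂(M.law θ₀)

/-- Regularity: on an open neighbourhood of `θ₀` (on which `h(θ, ·)` is defined) the first and
second partial derivatives of `φ'(p_θ / p_α) p_θ` in `α` exist and are dominated by an integrable
function, and the partial derivatives of `h(θ, α, x)` in `α` up to the third order exist, those of
the third order being dominated by a `P_{θ₀}`-integrable function. -/
def CondR2 (φ : ℝ → ℝ) (M : Model d 𝒳) (θ θ₀ : Param d) : Prop :=
  ∃ N : Set (Param d), IsOpen N ∧ θ₀ ∈ N ∧ N ⊆ finiteSet φ M θ ∧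
    (∃ G : 𝒳 → ℝ, Integrable G M.dom ∧ ∀ᵐ x ∂M.dom,
      HasPartialsOn 2 (fun β => dualIntegrand φ M θ β x) N ∧
      ∀ α ∈ N, ∀ i j : Fin d,
        |pd i (fun β => dualIntegrand φ M θ β x) α| ≤ G x ∧
        |pd i (pd j fun β => dualIntegrand φ M θ β x) α| ≤ G x) ∧
    (∃ H : 𝒳 → ℝ, Integrable H (M.law θ₀) ∧ ∀ᵐ x ∂(M.law θ₀),
      HasPartialsOn 3 (fun β => h φ M θ β x) N ∧
      ∀ α ∈ N, ∀ i j k : Fin d,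
        |pd i (pd j (pd k fun β => h φ M θ β x)) α| ≤ H x)

/-- The matrices `S` and `V` exist and are nonsingular. -/
structure CondR3 (φ : ℝ → ℝ) (M : Model d 𝒳) (θ θ₀ : Param d) : Prop where
  integrable_hess : ∀ i j, Integrable (fun x => hessH φ M θ θ₀ x i j) (M.law θ₀)
  memLp_grad : ∀ i, MemLp (fun x => gradH φ M θ θ₀ x i) 2 (M.law θ₀)
  det_S_ne_zero : (matS φ M θ θ₀).det ≠ 0
  det_V_ne_zero : (matV φ M θ θ₀).det ≠ 0

section Sample

variable {Ω : Type*}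

/-- The empirical mean `P_n f = (1/n) ∑ f(X_i)` over the first `n` observations. -/
def empMean (X : ℕ → Ω → 𝒳) (n : ℕ) (ω : Ω) (f : 𝒳 → ℝ) : ℝ :=
  (n : ℝ)⁻¹ * ∑ i ∈ Finset.range n, f (X i ω)

/-- `U_n(θ₀) = P_n ∂h(θ, θ₀)/∂α`. -/
def score (φ : ℝ → ℝ) (M : Model d 𝒳) (θ θ₀ : Param d) (X : ℕ → Ω → 𝒳) (n : ℕ) (ω : Ω) :
    Fin d → ℝ :=
  fun i => empMean X n ω fun x => gradH φ M θ θ₀ x i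

/-- `Δ_n = θ₀ + S⁻¹ U_n(θ₀)`. -/
def center (φ : ℝ → ℝ) (M : Model d 𝒳) (θ θ₀ : Param d) (X : ℕ → Ω → 𝒳) (n : ℕ) (ω : Ω) :
    Param d :=
  θ₀ + WithLp.toLp 2 ((matS φ M θ θ₀)⁻¹ *ᵥ score φ M θ θ₀ X n ω)

/-- The quadratic form `tᵀ S t`. -/
def quadForm (S : Matrix (Fin d) (Fin d) ℝ) (t : Param d) : ℝ := t.ofLp ⬝ᵥ (S *ᵥ t.ofLp)

/-- The remainder `R_n(α)` of the expansion
`P_n h(θ,α) - P_n h(θ,θ₀) = (α-θ₀)ᵀ U_n(θ₀) - (1/2) (α-θ₀)ᵀ S (α-θ₀) + R_n(α)`. -/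
def remainder (φ : ℝ → ℝ) (M : Model d 𝒳) (θ θ₀ : Param d) (X : ℕ → Ω → 𝒳) (n : ℕ) (ω : Ω)
    (α : Param d) : ℝ :=
  empMean X n ω (h φ M θ α) - empMean X n ω (h φ M θ θ₀)
    - (α - θ₀).ofLp ⬝ᵥ score φ M θ θ₀ X n ω
    + 1 / 2 * quadForm (matS φ M θ θ₀) (α - θ₀)

/-- The unnormalized `φ`-posterior density `exp(n P_n h(θ,α)) π(α)`. -/
def posteriorWeight (φ : ℝ → ℝ) (M : Model d 𝒳) (θ : Param d) (prior : Param d → ℝ)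
    (X : ℕ → Ω → 𝒳) (n : ℕ) (ω : Ω) (α : Param d) : ℝ :=
  Real.exp (n * empMean X n ω (h φ M θ α)) * prior α

/-- The `φ`-posterior density `p_{φ,n}`, carried by `𝒰`. -/
def posterior (φ : ℝ → ℝ) (M : Model d 𝒳) (θ : Param d) (prior : Param d → ℝ)
    (X : ℕ → Ω → 𝒳) (n : ℕ) (ω : Ω) (α : Param d) : ℝ :=
  (finiteSet φ M θ).indicator (posteriorWeight φ M θ prior X n ω) α /
    ∫ β in finiteSet φ M θ, posteriorWeight φ M θ prior X n ω β

/-- The `φ`-posterior density `p*_{φ,n}` of `t = √n (α - Δ_n)`, by change of variables. -/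
def rescaledPosterior (φ : ℝ → ℝ) (M : Model d 𝒳) (θ θ₀ : Param d) (prior : Param d → ℝ)
    (X : ℕ → Ω → 𝒳) (n : ℕ) (ω : Ω) (t : Param d) : ℝ :=
  (√(n : ℝ) ^ d)⁻¹ *
    posterior φ M θ prior X n ω ((√(n : ℝ))⁻¹ • t + center φ M θ θ₀ X n ω)

/-- The density at `t` of the centred Gaussian law on `ℝ^d` with precision matrix `S`. -/
def gaussianDensity (S : Matrix (Fin d) (Fin d) ℝ) (t : Param d) : ℝ :=
  √(S.det / (2 * Real.pi) ^ d) * Real.exp (-(1 / 2) * quadForm S t)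

variable [MeasurableSpace Ω]

/-- `sup_α |P_n h(θ,α) - P_{θ₀} h(θ,α)| → 0` almost surely, the means `P_{θ₀} h(θ,α)` being
defined. -/
structure CondR1 (φ : ℝ → ℝ) (M : Model d 𝒳) (θ θ₀ : Param d) (μ : Measure Ω)
    (X : ℕ → Ω → 𝒳) : Prop where
  integrable_h : ∀ α ∈ finiteSet φ M θ, Integrable (h φ M θ α) (M.law θ₀)
  tendsto_sup : ∀ᵐ ω ∂μ, Tendsto
    (fun n : ℕ => ⨆ α ∈ finiteSet φ M θ,
      ‖empMean X n ω (h φ M θ α) - ∫ x, h φ M θ α x ∂(M.law θ₀)‖ₑ) atTop (𝓝 0)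

/-- For every `ε > 0` there is `δ > 0` such that the probability of
`sup_{|α - θ₀| ≤ δ} |R_n(α)| ≥ ε` tends to `0`. -/
def CondR4 (φ : ℝ → ℝ) (M : Model d 𝒳) (θ θ₀ : Param d) (μ : Measure Ω)
    (X : ℕ → Ω → 𝒳) : Prop :=
  ∀ ε : ℝ, 0 < ε → ∃ δ : ℝ, 0 < δ ∧
    Tendsto (fun n : ℕ => μ {ω | ENNReal.ofReal ε ≤
      ⨆ α ∈ Metric.closedBall θ₀ δ, ‖remainder φ M θ θ₀ X n ω α‖ₑ}) atTop (𝓝 0)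

end Sample

end Model

end PhiPosterior

end

/-! The criterion `P_{θ₀} h(θ, ·)` is maximal at `θ₀`: its deficit at `α` is the `P_{θ₀}`-mean of
the Bregman divergence of `φ` between the ratios `p_θ/p_{θ₀}` and `p_θ/p_α` (`integral_h_gap`).
Integrating the pointwise Taylor bound then shows that the mean score vanishes and that `S` is
positive semidefinite, hence positive definite because it is nonsingular (`posDef_matS`).

The maximum is well separated. If the deficit tended to `0` along parameters away from `θ₀`, the
ratios would converge almost everywhere along a subsequence, and Scheffé's argument would make the
densities converge in `L¹`, against identifiability (`exists_integral_h_le_sub`). The uniform law of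
large numbers passes this gap on to `P_n h`.

The rest is Laplace's method for a fixed sample path. With `w = S⁻¹ U_n`, completing the square in
the Taylor expansion makes `n P_n h(θ, θ₀ + v)` equal to a constant minus `tᵀSt/2`, where `t = √n (v
- w)`, up to a remainder governed by the Hessian error and the averaged third-order bound. As long
as `√n ‖w‖` is bounded, a small ball around `θ₀` is handled by dominated convergence, its complement
contributes at most a constant times `n^{d/2} exp(-nκ)`, and normalization preserves `L¹`
convergence (`tendsto_lintegral_rescaled_sub_gaussian`).

Boundedness of `√n U_n` is needed only with probability close to one, uniformly in `n`, so
Chebyshev's inequality replaces a central limit theorem. Almost sure convergence along the sample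
sizes with bounded score then gives convergence in probability. -/

noncomputable section

namespace PhiPosterior

/-! ### Taylor expansion from partial derivatives. -/

section Calculus

variable {d : ℕ}

theorem hasDerivAt_line {f : Param d → ℝ} {x v : Param d} {t : ℝ}
    (h : LineDifferentiableAt ℝ f (x + t • v) v) :
    HasDerivAt (fun s : ℝ => f (x + s • v)) (lineDeriv ℝ f (x + t • v) v) t := by
  have h1 : HasDerivAt (fun s : ℝ => f (x + t • v + s • v)) (lineDeriv ℝ f (x + t • v) v)
      (t - t) := by
    rw [sub_self]; exact h.hasLineDerivAt
  have h2 := h1.comp_sub_const t t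
  refine h2.congr_of_eventuallyEq (Eventually.of_forall fun s => ?_)
  simp only [sub_smul]
  congr 1
  abel

/-- A function whose partial derivatives are bounded on a cube is Lipschitz there. -/
theorem abs_sub_le_of_partials {f : Param d → ℝ} {c a b : Param d} {r K : ℝ}
    (hf : ∀ x : Param d, (∀ i, |x i - c i| < r) → ∀ i,
      LineDifferentiableAt ℝ f x (EuclideanSpace.single i 1) ∧ |pd i f x| ≤ K)
    (ha : ∀ i, |a i - c i| < r) (hb : ∀ i, |b i - c i| < r) :
    |f b - f a| ≤ K * ∑ i, |b i - a i| := by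
  classical
  -- Move from `a` to `b` one coordinate at a time. Each coordinate of an intermediate point lies
  -- between those of `a` and `b`, so the path stays in the cube.
  have key : ∀ s : Finset (Fin d),
      |f (WithLp.toLp 2 (s.piecewise b.ofLp a.ofLp)) - f a| ≤ K * ∑ i ∈ s, |b i - a i| := by
    intro s
    induction s using Finset.induction_on with
    | empty => simp
    | insert j s hj ih =>
      rw [Finset.sum_insert hj, mul_add]
      set p : Param d := WithLp.toLp 2 (s.piecewise b.ofLp a.ofLp) with hp
      have hpj : p j = a j := by simp [hp, hj]
      have hq : (WithLp.toLp 2 ((insert j s).piecewise b.ofLp a.ofLp) : Param d)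
          = p + (b j - a j) • EuclideanSpace.single j 1 := by
        ext i
        by_cases hij : i = j
        · subst hij; simp [hpj]
        · simp [hp, Finset.piecewise, Finset.mem_insert, hij]
      have hbox : ∀ t ∈ uIcc (0 : ℝ) (b j - a j), ∀ i,
          |(p + t • EuclideanSpace.single j (1 : ℝ)) i - c i| < r := by
        intro t ht i
        by_cases hij : i = j
        · subst hij
          have h1 := abs_lt.1 (ha i)
          have h2 := abs_lt.1 (hb i)
          have : (p + t • EuclideanSpace.single i (1 : ℝ)) i = a i + t := by simp [hpj]
          rw [this, abs_lt]
          rcases mem_uIcc.1 ht with h | h <;> constructor <;> linarith [h.1, h.2]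
        · have : (p + t • EuclideanSpace.single j (1 : ℝ)) i = p i := by simp [hij]
          rw [this]
          by_cases his : i ∈ s
          · simpa [hp, his] using hb i
          · simpa [hp, his] using ha i
      have hmvt := Convex.norm_image_sub_le_of_norm_hasDerivWithin_le
        (f := fun t : ℝ => f (p + t • EuclideanSpace.single j (1 : ℝ)))
        (f' := fun t => pd j f (p + t • EuclideanSpace.single j (1 : ℝ)))
        (s := uIcc (0 : ℝ) (b j - a j)) (C := K)
        (fun t ht => (hasDerivAt_line (hf _ (hbox t ht) j).1).hasDerivWithinAt)
        (fun t ht => (hf _ (hbox t ht) j).2) (convex_uIcc _ _) left_mem_uIcc right_mem_uIcc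
      simp only [Real.norm_eq_abs, zero_smul, add_zero, sub_zero] at hmvt
      rw [hq]
      calc _ = |(f (p + (b j - a j) • EuclideanSpace.single j (1 : ℝ)) - f p) + (f p - f a)| := by
            congr 1; ring
        _ ≤ _ := (abs_add_le _ _).trans (add_le_add hmvt ih)
  have := key Finset.univ
  simpa using this

/-- Cubes are stable under mixing the coordinates of two points, which is what
`abs_sub_le_of_partials` needs. -/
theorem exists_cube_subset {N : Set (Param d)} (hN : IsOpen N) {a : Param d} (ha : a ∈ N) :
    ∃ r : ℝ, 0 < r ∧ ∀ x : Param d, (∀ i, |x i - a i| < r) → x ∈ N := by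
  have ho : IsOpen ((WithLp.toLp 2 : (Fin d → ℝ) → Param d) ⁻¹' N) :=
    hN.preimage (PiLp.continuous_toLp 2 _)
  obtain ⟨r, hr, hsub⟩ := Metric.isOpen_iff.1 ho a.ofLp ha
  refine ⟨r, hr, fun x hx => ?_⟩
  have : x.ofLp ∈ Metric.ball a.ofLp r := by
    rw [Metric.mem_ball, dist_pi_lt_iff hr]
    intro i
    rw [Real.dist_eq]; exact hx i
  exact hsub this

theorem abs_coord_le (x : Param d) (i : Fin d) : |x i| ≤ ‖x‖ := by
  simpa using PiLp.norm_apply_le x i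

theorem sum_abs_coord_le (x : Param d) : ∑ i, |x i| ≤ d * ‖x‖ := by
  calc ∑ i, |x i| ≤ ∑ _i : Fin d, ‖x‖ := Finset.sum_le_sum fun i _ => abs_coord_le x i
    _ = _ := by simp

theorem continuousAt_of_partials_bounded {f : Param d → ℝ} {N : Set (Param d)} {K : ℝ}
    (hN : IsOpen N) (hd : ∀ i, ∀ α ∈ N, LineDifferentiableAt ℝ f α (EuclideanSpace.single i 1))
    (hb : ∀ α ∈ N, ∀ i, |pd i f α| ≤ K) {a : Param d} (ha : a ∈ N) : ContinuousAt f a := by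
  obtain ⟨r, hr, hsub⟩ := exists_cube_subset hN ha
  rw [ContinuousAt, tendsto_iff_norm_sub_tendsto_zero]
  have hlim : Tendsto (fun x : Param d => K * ∑ i, |x i - a i|) (𝓝 a) (𝓝 0) := by
    have : Continuous (fun x : Param d => K * ∑ i, |x i - a i|) := by fun_prop
    simpa using this.tendsto a
  refine squeeze_zero' (Eventually.of_forall fun _ => norm_nonneg _) ?_ hlim
  filter_upwards [Metric.ball_mem_nhds a hr] with x hx
  refine abs_sub_le_of_partials (c := a) (r := r)
    (fun y hy i => ⟨hd i y (hsub y hy), hb y (hsub y hy) i⟩) (by simpa using fun _ => hr) ?_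
  intro i
  rw [Metric.mem_ball, dist_eq_norm] at hx
  simpa using (abs_coord_le (x - a) i).trans_lt hx

/-- A function with partial derivatives on an open set is differentiable where these are
continuous. -/
theorem hasFDerivAt_of_continuousAt_partials {f : Param d → ℝ} {N : Set (Param d)}
    (hN : IsOpen N) (hd : ∀ i, ∀ α ∈ N, LineDifferentiableAt ℝ f α (EuclideanSpace.single i 1))
    {a : Param d} (ha : a ∈ N) (hc : ∀ i, ContinuousAt (pd i f) a) :
    HasFDerivAt f (∑ i, pd i f a • (EuclideanSpace.proj i : Param d →L[ℝ] ℝ)) a := by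
  set L : Param d →L[ℝ] ℝ := ∑ i, pd i f a • (EuclideanSpace.proj i : Param d →L[ℝ] ℝ) with hL
  have hLe : ∀ i, L (EuclideanSpace.single i 1) = pd i f a := by
    intro i
    simp [hL]
  rw [hasFDerivAt_iff_isLittleO, Asymptotics.isLittleO_iff]
  intro c hc0
  -- Summing over coordinates costs a factor `d`; dividing by `d + 1` absorbs it and also covers `d
  -- = 0`.
  have hev : ∀ᶠ x in 𝓝 a, ∀ i, |pd i f x - pd i f a| < c / (d + 1) := by
    refine eventually_all.2 fun i => ?_
    have := Metric.tendsto_nhds.1 (hc i) (c / (d + 1)) (by positivity)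
    simpa [Real.dist_eq] using this
  obtain ⟨O, hOsub, hO, haO⟩ := mem_nhds_iff.1 (hev.and (hN.mem_nhds ha))
  obtain ⟨r, hr, hsub⟩ := exists_cube_subset hO haO
  filter_upwards [Metric.ball_mem_nhds a hr] with x hx
  have hx' : ∀ i, |x i - a i| < r := by
    intro i
    rw [Metric.mem_ball, dist_eq_norm] at hx
    simpa using (abs_coord_le (x - a) i).trans_lt hx
  have := abs_sub_le_of_partials (f := fun y => f y - L y) (a := a) (b := x) (c := a) (r := r)
    (K := c / (d + 1)) (fun y hy i => by
      have hy' := hOsub (hsub y hy)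
      have h1 : HasLineDerivAt ℝ f (pd i f y) y (EuclideanSpace.single i 1) :=
        (hd i y hy'.2).hasLineDerivAt
      have h2 : HasLineDerivAt ℝ (fun y => L y) (pd i f a) y (EuclideanSpace.single i 1) := by
        rw [← hLe]; exact (L.hasFDerivAt (x := y)).hasLineDerivAt _
      have h3 : HasLineDerivAt ℝ (fun y => f y - L y) (pd i f y - pd i f a) y
          (EuclideanSpace.single i 1) := HasDerivAt.fun_sub h1 h2
      refine ⟨h3.lineDifferentiableAt, ?_⟩
      rw [pd, h3.lineDeriv]
      exact (hy'.1 i).le) (by simpa using fun _ => hr) hx'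
  have h4 : f x - f a - L (x - a) = (f x - L x) - (f a - L a) := by rw [map_sub]; ring
  rw [h4, Real.norm_eq_abs]
  refine this.trans ?_
  have h5 : ∑ i, |x i - a i| ≤ d * ‖x - a‖ := sum_abs_coord_le (x - a)
  calc c / (d + 1) * ∑ i, |x i - a i| ≤ c / (d + 1) * (d * ‖x - a‖) := by gcongr
    _ = c * ‖x - a‖ * (d / (d + 1)) := by ring
    _ ≤ c * ‖x - a‖ * 1 := by
        gcongr
        rw [div_le_one (by positivity)]; linarith
    _ = _ := mul_one _

section Third

variable {f : Param d → ℝ} {N : Set (Param d)} {K : ℝ}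

/-- The third partials are merely bounded, but this makes the second ones locally Lipschitz. Their
continuity gives Fréchet differentiability of the first partials, and then of `f`. -/
theorem continuousAt_pd_pd (hN : IsOpen N) (hp : HasPartialsOn 3 f N)
    (hb : ∀ α ∈ N, ∀ i j k : Fin d, |pd i (pd j (pd k f)) α| ≤ K) {a : Param d} (ha : a ∈ N)
    (j k : Fin d) : ContinuousAt (pd j (pd k f)) a :=
  continuousAt_of_partials_bounded hN (fun i => (((hp k).2 j).2 i).1) (fun α hα i => hb α hα i j k)
    ha

theorem hasFDerivAt_pd (hN : IsOpen N) (hp : HasPartialsOn 3 f N)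
    (hb : ∀ α ∈ N, ∀ i j k : Fin d, |pd i (pd j (pd k f)) α| ≤ K) {a : Param d} (ha : a ∈ N)
    (k : Fin d) : HasFDerivAt (pd k f)
      (∑ i, pd i (pd k f) a • (EuclideanSpace.proj i : Param d →L[ℝ] ℝ)) a :=
  hasFDerivAt_of_continuousAt_partials hN (fun i => ((hp k).2 i).1) ha
    fun i => continuousAt_pd_pd hN hp hb ha i k

theorem hasFDerivAt_of_hasPartialsOn (hN : IsOpen N) (hp : HasPartialsOn 3 f N)
    (hb : ∀ α ∈ N, ∀ i j k : Fin d, |pd i (pd j (pd k f)) α| ≤ K) {a : Param d} (ha : a ∈ N) :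
    HasFDerivAt f (∑ i, pd i f a • (EuclideanSpace.proj i : Param d →L[ℝ] ℝ)) a :=
  hasFDerivAt_of_continuousAt_partials hN (fun i => (hp i).1) ha
    fun i => (hasFDerivAt_pd hN hp hb ha i).continuousAt

/-- Schwarz's theorem: the Fréchet derivative exists near `a` and is itself differentiable at `a`.
The symmetry of `S` comes from here. -/
theorem pd_comm (hN : IsOpen N) (hp : HasPartialsOn 3 f N)
    (hb : ∀ α ∈ N, ∀ i j k : Fin d, |pd i (pd j (pd k f)) α| ≤ K) {a : Param d} (ha : a ∈ N)
    (i j : Fin d) : pd i (pd j f) a = pd j (pd i f) a := by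
  have h1 : ∀ᶠ y in 𝓝 a, HasFDerivAt f
      (∑ i, pd i f y • (EuclideanSpace.proj i : Param d →L[ℝ] ℝ)) y := by
    filter_upwards [hN.mem_nhds ha] with y hy using hasFDerivAt_of_hasPartialsOn hN hp hb hy
  have h2 : HasFDerivAt (fun y => ∑ i, pd i f y • (EuclideanSpace.proj i : Param d →L[ℝ] ℝ))
      (∑ k, (∑ i, pd i (pd k f) a • (EuclideanSpace.proj i : Param d →L[ℝ] ℝ)).smulRight
        (EuclideanSpace.proj k : Param d →L[ℝ] ℝ)) a :=
    HasFDerivAt.fun_sum fun k _ => (hasFDerivAt_pd hN hp hb ha k).smul_const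
      (EuclideanSpace.proj k : Param d →L[ℝ] ℝ)
  have := second_derivative_symmetric_of_eventually h1 h2
    (EuclideanSpace.single i 1) (EuclideanSpace.single j 1)
  simpa [_root_.sum_apply] using this

/-- The second order Taylor expansion, with the remainder bounded through the third partials. -/
theorem abs_taylor_two_le (hN : IsOpen N) (hp : HasPartialsOn 3 f N)
    (hb : ∀ α ∈ N, ∀ i j k : Fin d, |pd i (pd j (pd k f)) α| ≤ K) {a : Param d} {r : ℝ}
    (hr : ∀ x : Param d, (∀ i, |x i - a i| < r) → x ∈ N) {v : Param d} (hv : ‖v‖ < r) :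
    |f (a + v) - f a - ∑ i, v i * pd i f a - 1 / 2 * ∑ i, ∑ j, v i * v j * pd i (pd j f) a|
      ≤ d ^ 3 * K * ‖v‖ ^ 3 := by
  have hr0 : 0 < r := (norm_nonneg v).trans_lt hv
  have hbox : ∀ t ∈ Icc (0 : ℝ) 1, ∀ i, |(a + t • v) i - a i| < r := by
    intro t ht i
    have : (a + t • v) i - a i = t * v i := by simp
    rw [this, abs_mul, abs_of_nonneg ht.1]
    calc t * |v i| ≤ 1 * |v i| := by gcongr; exact ht.2
      _ ≤ ‖v‖ := by rw [one_mul]; exact abs_coord_le v i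
      _ < r := hv
  have hmem : ∀ t ∈ Icc (0 : ℝ) 1, a + t • v ∈ N := fun t ht => hr _ (hbox t ht)
  have hline : ∀ t : ℝ, HasDerivAt (fun t : ℝ => a + t • v) v t := fun t => by
    simpa using ((hasDerivAt_id t).smul_const v).const_add a
  have hg1 : ∀ t ∈ Icc (0 : ℝ) 1,
      HasDerivAt (fun t : ℝ => f (a + t • v)) (∑ i, v i * pd i f (a + t • v)) t := by
    intro t ht
    have := (hasFDerivAt_of_hasPartialsOn hN hp hb (hmem t ht)).comp_hasDerivAt t (hline t)
    convert! this using 1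
    simp [mul_comm]
  have hg2 : ∀ t ∈ Icc (0 : ℝ) 1, HasDerivAt (fun t : ℝ => ∑ j, v j * pd j f (a + t • v))
      (∑ j, ∑ i, v i * v j * pd i (pd j f) (a + t • v)) t := by
    intro t ht
    refine HasDerivAt.fun_sum fun j _ => ?_
    have := ((hasFDerivAt_pd hN hp hb (hmem t ht) j).comp_hasDerivAt t (hline t)).const_mul (v j)
    convert! this using 1
    simp only [_root_.sum_apply, Finset.mul_sum]
    refine Finset.sum_congr rfl fun i _ => ?_
    simp; ring
  -- The sign of `K` is known only once an index exists; for `d = 0` all sums are empty.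
  have hK : ∀ i : Fin d, 0 ≤ K := fun i =>
    (abs_nonneg _).trans (hb a (hr a (by simpa using fun _ => hr0)) i i i)
  have hB : ∀ t ∈ Icc (0 : ℝ) 1, ‖(∑ j, ∑ i, v i * v j * pd i (pd j f) (a + t • v))
      - ∑ j, ∑ i, v i * v j * pd i (pd j f) a‖ ≤ d ^ 3 * K * ‖v‖ ^ 3 := by
    intro t ht
    have hterm : ∀ j i : Fin d, |v i * v j * pd i (pd j f) (a + t • v)
        - v i * v j * pd i (pd j f) a| ≤ K * d * ‖v‖ ^ 3 := by
      intro j i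
      have h1 := abs_sub_le_of_partials (f := pd i (pd j f)) (a := a) (b := a + t • v) (c := a)
        (r := r) (K := K) (fun y hy k => ⟨(((hp j).2 i).2 k).1 y (hr y hy), hb y (hr y hy) k i j⟩)
        (by simpa using fun _ => hr0) (hbox t ht)
      have h2 : ∑ k, |(a + t • v) k - a k| ≤ d * ‖v‖ := by
        refine le_trans (le_of_eq ?_) ((sum_abs_coord_le (t • v)).trans ?_)
        · simp
        · rw [norm_smul, Real.norm_eq_abs, abs_of_nonneg ht.1]
          have := mul_le_of_le_one_left (norm_nonneg v) ht.2
          gcongr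
      rw [← mul_sub, abs_mul, abs_mul]
      have := hK i
      calc |v i| * |v j| * |pd i (pd j f) (a + t • v) - pd i (pd j f) a|
          ≤ ‖v‖ * ‖v‖ * (K * (d * ‖v‖)) := by
            gcongr
            · exact abs_coord_le v i
            · exact abs_coord_le v j
            · exact h1.trans (by gcongr)
        _ = _ := by ring
    simp only [← Finset.sum_sub_distrib]
    calc _ ≤ ∑ _j : Fin d, ∑ _i : Fin d, K * d * ‖v‖ ^ 3 :=
          (norm_sum_le _ _).trans (Finset.sum_le_sum fun j _ =>
            (norm_sum_le _ _).trans (Finset.sum_le_sum fun i _ => hterm j i))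
      _ = _ := by simp; ring
  -- Two factors `d` count the pairs of indices and the third comes from the `ℓ¹` norm. The mean
  -- value inequality is applied twice on `[0, 1]` with the crude bound `B`, so no factor `1/6`
  -- appears.
  set B := (d : ℝ) ^ 3 * K * ‖v‖ ^ 3
  set G1 := ∑ j, v j * pd j f a with hG1
  set G2 := ∑ j, ∑ i, v i * v j * pd i (pd j f) a with hG2
  have hB0 : 0 ≤ B := (norm_nonneg _).trans (hB 0 (by simp))
  have step1 : ∀ t ∈ Icc (0 : ℝ) 1, ‖(∑ j, v j * pd j f (a + t • v)) - G1 - t * G2‖ ≤ B := by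
    intro t ht
    have hC := Convex.norm_image_sub_le_of_norm_hasDerivWithin_le
      (f := fun s => (∑ j, v j * pd j f (a + s • v)) - s * G2) (C := B)
      (f' := fun s => (∑ j, ∑ i, v i * v j * pd i (pd j f) (a + s • v)) - G2) (s := Icc (0 : ℝ) 1)
      (x := 0) (y := t)
      (fun s hs => by
        have := (hg2 s hs).fun_sub ((hasDerivAt_id s).mul_const G2)
        simpa using this.hasDerivWithinAt) (fun s hs => hB s hs) (convex_Icc _ _) (by simp) ht
    have h0 : (∑ j, v j * pd j f (a + (0 : ℝ) • v)) = G1 := by simp [hG1]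
    rw [h0, zero_mul, sub_zero, sub_zero] at hC
    calc _ = ‖(∑ j, v j * pd j f (a + t • v)) - t * G2 - G1‖ := by congr 1; ring
      _ ≤ B * ‖t‖ := hC
      _ ≤ B * 1 := by
        gcongr; rw [Real.norm_eq_abs, abs_of_nonneg ht.1]; exact ht.2
      _ = B := mul_one _
  have hfin := norm_image_sub_le_of_norm_deriv_le_segment_01'
      (f := fun s => f (a + s • v) - s * G1 - s ^ 2 / 2 * G2) (C := B)
      (f' := fun s => (∑ j, v j * pd j f (a + s • v)) - G1 - s * G2)
      (fun s hs => by
        have h := ((hg1 s hs).fun_sub ((hasDerivAt_id s).mul_const G1)).fun_sub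
          ((((hasDerivAt_id s).fun_pow 2).div_const 2).mul_const G2)
        simpa using h.hasDerivWithinAt) (fun s hs => step1 s ⟨hs.1, hs.2.le⟩)
  rw [Real.norm_eq_abs] at hfin
  have hsw : ∑ i, ∑ j, v i * v j * pd i (pd j f) a = G2 := by
    rw [hG2, Finset.sum_comm]
  rw [hsw]
  refine le_trans (le_of_eq ?_) hfin
  congr 1
  simp
  ring

end Third

end Calculus

/-! ### Bregman divergences of the generator. -/

section Bregman

/-- The Bregman divergence `φ(a) - φ(b) - φ'(b) (a - b)`. -/
def bregman (φ : ℝ → ℝ) (a b : ℝ) : ℝ := φ a - φ b - deriv φ b * (a - b)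

variable {φ : ℝ → ℝ}

theorem IsDivergenceGenerator.differentiableAt (hφ : IsDivergenceGenerator φ) {u : ℝ}
    (hu : 0 < u) : DifferentiableAt ℝ φ u :=
  (hφ.contDiffOn.differentiableOn (by norm_num)).differentiableAt (Ioi_mem_nhds hu)

theorem IsDivergenceGenerator.bregman_pos (hφ : IsDivergenceGenerator φ) {a b : ℝ} (ha : 0 < a)
    (hb : 0 < b) (hab : a ≠ b) : 0 < bregman φ a b := by
  have hd := hφ.differentiableAt hb
  unfold bregman
  rcases lt_or_gt_of_ne hab with h | h
  · have := hφ.strictConvexOn.slope_lt_deriv ha hb h hd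
    rw [slope_def_field, div_lt_iff₀ (by linarith)] at this
    linarith
  · have := hφ.strictConvexOn.deriv_lt_slope hb ha h hd
    rw [slope_def_field, lt_div_iff₀ (by linarith)] at this
    linarith

theorem IsDivergenceGenerator.bregman_nonneg (hφ : IsDivergenceGenerator φ) {a b : ℝ} (ha : 0 < a)
    (hb : 0 < b) : 0 ≤ bregman φ a b := by
  rcases eq_or_ne a b with rfl | h
  · simp [bregman]
  · exact (hφ.bregman_pos ha hb h).le

theorem IsDivergenceGenerator.monotoneOn_deriv (hφ : IsDivergenceGenerator φ) :
    MonotoneOn (deriv φ) (Ioi 0) :=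
  hφ.strictConvexOn.convexOn.monotoneOn_deriv fun _ hx => hφ.differentiableAt hx

/-- Three-point identity: `bregman φ a s - bregman φ a b = bregman φ b s + (φ' s - φ' b) (b - a)`,
and both terms are nonnegative when `b` lies between `a` and `s`. -/
theorem IsDivergenceGenerator.bregman_mono (hφ : IsDivergenceGenerator φ) {a b s : ℝ}
    (hb : 0 < b) (hs : 0 < s) (h : a ≤ b ∧ b ≤ s ∨ s ≤ b ∧ b ≤ a) :
    bregman φ a b ≤ bregman φ a s := by
  have h1 := hφ.bregman_nonneg hb hs
  have h2 : 0 ≤ (deriv φ s - deriv φ b) * (b - a) := by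
    rcases h with h | h
    · exact mul_nonneg (sub_nonneg.2 (hφ.monotoneOn_deriv hb hs h.2)) (by linarith [h.1])
    · exact mul_nonneg_of_nonpos_of_nonpos (sub_nonpos.2 (hφ.monotoneOn_deriv hs hb h.1))
        (by linarith [h.2])
  unfold bregman at *
  nlinarith

/-- By monotonicity, lying beyond a barrier `c ≠ a` costs at least `bregman φ a c > 0`. -/
theorem IsDivergenceGenerator.tendsto_of_bregman (hφ : IsDivergenceGenerator φ) {ι : Type*}
    {l : Filter ι} {a : ℝ} (ha : 0 < a) {s : ι → ℝ} (hs : ∀ k, 0 < s k)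
    (h : Tendsto (fun k => bregman φ a (s k)) l (𝓝 0)) : Tendsto s l (𝓝 a) := by
  rw [tendsto_order]
  constructor
  · intro c hc
    -- The barrier must lie in `(0, a)`, whereas `c` may be nonpositive.
    have hc' : 0 < max c (a / 2) := lt_max_of_lt_right (by linarith)
    have hca : max c (a / 2) < a := max_lt hc (by linarith)
    filter_upwards [h.eventually (gt_mem_nhds (hφ.bregman_pos ha hc' hca.ne'))] with k hk
    by_contra! hcon
    exact absurd (hφ.bregman_mono hc' (hs k) (Or.inr ⟨hcon.trans (le_max_left _ _), hca.le⟩))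
      (not_le.2 hk)
  · intro c hc
    have hc' : 0 < c := ha.trans hc
    filter_upwards [h.eventually (gt_mem_nhds (hφ.bregman_pos ha hc' hc.ne))] with k hk
    by_contra! hcon
    exact absurd (hφ.bregman_mono hc' (hs k) (Or.inl ⟨hc.le, hcon⟩)) (not_le.2 hk)

/-- Nothing is assumed about `φ` off `(0, ∞)`, so only the truncated function is measurable. -/
theorem IsDivergenceGenerator.measurable_indicator (hφ : IsDivergenceGenerator φ) :
    Measurable ((Ioi (0 : ℝ)).indicator φ) := by
  classical
  rw [← piecewise_eq_indicator]
  exact hφ.contDiffOn.continuousOn.measurable_piecewise continuousOn_const measurableSet_Ioi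

end Bregman

/-! ### Measurability and integration in the model. -/

section Measurability

variable {d : ℕ} {𝒳 : Type*} [MeasurableSpace 𝒳] {φ : ℝ → ℝ} {M : Model d 𝒳}
  {θ θ₀ α : Param d}

theorem Model.ratio_pos (hθ : θ ∈ M.Θ) (hα : α ∈ M.Θ) (x : 𝒳) : 0 < M.ratio θ α x :=
  div_pos (M.p_pos θ hθ x) (M.p_pos α hα x)

theorem Model.measurable_density (M : Model d 𝒳) (α : Param d) : Measurable (M.p α) :=
  M.measurable_p.comp measurable_prodMk_left

theorem Model.measurable_ratio (M : Model d 𝒳) (θ : Param d) :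
    Measurable fun z : Param d × 𝒳 => M.ratio θ z.1 z.2 :=
  ((M.measurable_density θ).comp measurable_snd).div M.measurable_p

theorem measurable_dualIntegrand (φ : ℝ → ℝ) (M : Model d 𝒳) (θ : Param d) :
    Measurable fun z : Param d × 𝒳 => dualIntegrand φ M θ z.1 z.2 :=
  ((measurable_deriv φ).comp (M.measurable_ratio θ)).mul
    ((M.measurable_density θ).comp measurable_snd)

/-- A jointly measurable function that agrees with `h(θ, α, x)` for `α ∈ Θ`. -/
def hReg (φ : ℝ → ℝ) (M : Model d 𝒳) (θ α : Param d) (x : 𝒳) : ℝ :=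
  (∫ y, dualIntegrand φ M θ α y ∂M.dom) -
    (M.ratio θ α x * deriv φ (M.ratio θ α x) - (Ioi 0).indicator φ (M.ratio θ α x))

theorem h_eq_hReg (hθ : θ ∈ M.Θ) (hα : α ∈ M.Θ) : h φ M θ α = hReg φ M θ α := by
  funext x
  rw [h, hReg, indicator_of_mem (mem_Ioi.2 (Model.ratio_pos hθ hα x))]

theorem measurable_hReg (hφ : IsDivergenceGenerator φ) (M : Model d 𝒳) (θ : Param d) :
    Measurable fun z : Param d × 𝒳 => hReg φ M θ z.1 z.2 := by
  have := M.sigmaFinite_dom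
  have h1 : Measurable fun α : Param d => ∫ y, dualIntegrand φ M θ α y ∂M.dom :=
    (StronglyMeasurable.integral_prod_right
      (measurable_dualIntegrand φ M θ).stronglyMeasurable).measurable
  have hr := M.measurable_ratio θ
  exact (h1.comp measurable_fst).sub
    ((hr.mul ((measurable_deriv φ).comp hr)).sub (hφ.measurable_indicator.comp hr))

/-- On `Θ` the divergence is the `M.dom`-integral of a jointly measurable nonnegative function,
hence measurable in `α` by Tonelli. -/
theorem measurableSet_finiteSet (hφ : IsDivergenceGenerator φ) (hθ : θ ∈ M.Θ) :
    MeasurableSet (finiteSet φ M θ) := by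
  have := M.sigmaFinite_dom
  set g : Param d → ℝ≥0∞ := fun α => ∫⁻ x, ENNReal.ofReal (M.p α x) *
    ENNReal.ofReal ((Ioi 0).indicator φ (M.ratio θ α x)) ∂M.dom with hg
  have hgm : Measurable g := by
    refine Measurable.lintegral_prod_right ?_
    exact (M.measurable_p.ennreal_ofReal).mul
      (hφ.measurable_indicator.comp (M.measurable_ratio θ)).ennreal_ofReal
  have : finiteSet φ M θ = M.Θ ∩ {α | g α < ∞} := by
    ext α
    refine and_congr_right fun hα => ?_
    have h1 : divergence φ M θ α = g α := by
      have h2 : divergence φ M θ α =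
          ∫⁻ x, ENNReal.ofReal ((Ioi 0).indicator φ (M.ratio θ α x)) ∂(M.law α) := by
        refine lintegral_congr fun x => ?_
        rw [indicator_of_mem (mem_Ioi.2 (Model.ratio_pos hθ hα x))]
      rw [h2, Model.law, lintegral_withDensity_eq_lintegral_mul _
        (M.measurable_density α).ennreal_ofReal]
      · rfl
      · exact (hφ.measurable_indicator.comp
          ((M.measurable_ratio θ).comp measurable_prodMk_left)).ennreal_ofReal
    rw [h1]; rfl
  rw [this]
  exact M.measurableSet_Θ.inter (measurableSet_lt hgm measurable_const)

theorem finiteSet_subset : finiteSet φ M θ ⊆ M.Θ := fun _ h => h.1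

theorem Model.isProbabilityMeasure_law (hα : α ∈ M.Θ) : IsProbabilityMeasure (M.law α) :=
  ⟨by rw [Model.law, withDensity_apply _ MeasurableSet.univ, Measure.restrict_univ,
    M.lintegral_p α hα]⟩

theorem Model.integrable_density (hα : α ∈ M.Θ) : Integrable (M.p α) M.dom := by
  refine ⟨(M.measurable_density α).aestronglyMeasurable, ?_⟩
  rw [hasFiniteIntegral_iff_ofReal (ae_of_all _ fun x => (M.p_pos α hα x).le),
    M.lintegral_p α hα]
  exact ENNReal.one_lt_top

theorem Model.integral_density (hα : α ∈ M.Θ) : ∫ x, M.p α x ∂M.dom = 1 := by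
  rw [integral_eq_lintegral_of_nonneg_ae (ae_of_all _ fun x => (M.p_pos α hα x).le)
    (M.measurable_density α).aestronglyMeasurable, M.lintegral_p α hα, ENNReal.toReal_one]

theorem Model.integral_law (hα : α ∈ M.Θ) (f : 𝒳 → ℝ) :
    ∫ x, f x ∂(M.law α) = ∫ x, M.p α x * f x ∂M.dom := by
  rw [Model.law, integral_withDensity_eq_integral_toReal_smul
    (M.measurable_density α).ennreal_ofReal (ae_of_all _ fun _ => ENNReal.ofReal_lt_top)]
  simp only [ENNReal.toReal_ofReal (M.p_pos α hα _).le, smul_eq_mul]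

theorem Model.integrable_law_iff (hα : α ∈ M.Θ) {f : 𝒳 → ℝ} :
    Integrable f (M.law α) ↔ Integrable (fun x => M.p α x * f x) M.dom := by
  rw [Model.law, integrable_withDensity_iff_integrable_smul'
    (M.measurable_density α).ennreal_ofReal (ae_of_all _ fun _ => ENNReal.ofReal_lt_top)]
  simp only [ENNReal.toReal_ofReal (M.p_pos α hα _).le, smul_eq_mul]

end Measurability

/-! ### Dual representation and separation of the maximum. -/

section Duality

variable {d : ℕ} {𝒳 : Type*} [MeasurableSpace 𝒳] {φ : ℝ → ℝ} {M : Model d 𝒳}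
  {θ θ₀ α : Param d}

/-- Since `p_{θ₀}` has mass one, the constant term of `h` can be moved back under the integral over
`M.dom`, so that everything becomes a single integrand. -/
theorem hasIntegral_h (hθ₀ : θ₀ ∈ M.Θ)
    (hd : Integrable (dualIntegrand φ M θ α) M.dom) (hh : Integrable (h φ M θ α) (M.law θ₀)) :
    Integrable (fun x => dualIntegrand φ M θ α x - M.p θ₀ x *
        (M.ratio θ α x * deriv φ (M.ratio θ α x) - φ (M.ratio θ α x))) M.dom ∧
      ∫ x, (dualIntegrand φ M θ α x - M.p θ₀ x *
        (M.ratio θ α x * deriv φ (M.ratio θ α x) - φ (M.ratio θ α x))) ∂M.dom =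
      ∫ x, h φ M θ α x ∂(M.law θ₀) := by
  have h1 := (Model.integrable_law_iff hθ₀).1 hh
  have h2 := (Model.integrable_density hθ₀).mul_const (∫ y, dualIntegrand φ M θ α y ∂M.dom)
  have h3 := (hd.sub h2).add h1
  have h4 : ((dualIntegrand φ M θ α - fun x => M.p θ₀ x * ∫ y, dualIntegrand φ M θ α y ∂M.dom)
      + fun x => M.p θ₀ x * h φ M θ α x) = fun x => dualIntegrand φ M θ α x - M.p θ₀ x *
        (M.ratio θ α x * deriv φ (M.ratio θ α x) - φ (M.ratio θ α x)) := by
    funext x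
    simp only [Pi.add_apply, Pi.sub_apply, h]
    ring
  rw [← h4]
  refine ⟨h3, ?_⟩
  rw [integral_add' (hd.sub h2) h1, integral_sub' hd h2, integral_mul_const,
    Model.integral_density hθ₀, Model.integral_law hθ₀]
  ring

/-- The gap `P_{θ₀} h(θ, θ₀) - P_{θ₀} h(θ, α)` in the dual representation of the divergence is the
mean of a Bregman divergence of the likelihood ratios. -/
theorem integral_h_gap (hθ₀ : θ₀ ∈ finiteSet φ M θ) (hα : α ∈ finiteSet φ M θ)
    (hint : ∀ α ∈ finiteSet φ M θ, Integrable (dualIntegrand φ M θ α) M.dom)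
    (hh : ∀ α ∈ finiteSet φ M θ, Integrable (h φ M θ α) (M.law θ₀)) :
    Integrable (fun x => M.p θ₀ x * bregman φ (M.ratio θ θ₀ x) (M.ratio θ α x)) M.dom ∧
      ∫ x, M.p θ₀ x * bregman φ (M.ratio θ θ₀ x) (M.ratio θ α x) ∂M.dom =
        ∫ x, h φ M θ θ₀ x ∂(M.law θ₀) - ∫ x, h φ M θ α x ∂(M.law θ₀) := by
  obtain ⟨i1, e1⟩ := hasIntegral_h hθ₀.1 (hint θ₀ hθ₀) (hh θ₀ hθ₀)
  obtain ⟨i2, e2⟩ := hasIntegral_h hθ₀.1 (hint α hα) (hh α hα)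
  have key : (fun x => M.p θ₀ x * bregman φ (M.ratio θ θ₀ x) (M.ratio θ α x)) =
      fun x => (dualIntegrand φ M θ θ₀ x - M.p θ₀ x *
        (M.ratio θ θ₀ x * deriv φ (M.ratio θ θ₀ x) - φ (M.ratio θ θ₀ x))) -
        (dualIntegrand φ M θ α x - M.p θ₀ x *
        (M.ratio θ α x * deriv φ (M.ratio θ α x) - φ (M.ratio θ α x))) := by
    funext x
    -- With `a = p_θ/p_{θ₀}` and `b = p_θ/p_α`, this factors `p_{θ₀}` out of the dual integrands;
    -- the terms in `φ' a` cancel and `φ a - φ b - φ' b (a - b)` remains.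
    have : M.p θ x = M.ratio θ θ₀ x * M.p θ₀ x := by
      rw [Model.ratio, div_mul_cancel₀ _ (M.p_pos θ₀ hθ₀.1 x).ne']
    simp only [bregman, dualIntegrand, this]
    ring
  rw [key, ← e1, ← e2, integral_sub i1 i2]
  exact ⟨i1.sub i2, rfl⟩

/-- The criterion `P_{θ₀} h(θ, ·)` is maximal at `θ₀`. -/
theorem integral_h_le (hφ : IsDivergenceGenerator φ) (hθ : θ ∈ M.Θ) (hθ₀ : θ₀ ∈ finiteSet φ M θ)
    (hα : α ∈ finiteSet φ M θ)
    (hint : ∀ α ∈ finiteSet φ M θ, Integrable (dualIntegrand φ M θ α) M.dom)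
    (hh : ∀ α ∈ finiteSet φ M θ, Integrable (h φ M θ α) (M.law θ₀)) :
    ∫ x, h φ M θ α x ∂(M.law θ₀) ≤ ∫ x, h φ M θ θ₀ x ∂(M.law θ₀) := by
  rw [← sub_nonneg, ← (integral_h_gap hθ₀ hα hint hh).2]
  exact integral_nonneg fun x => mul_nonneg (M.p_pos θ₀ hθ₀.1 x).le
    (hφ.bregman_nonneg (Model.ratio_pos hθ hθ₀.1 x) (Model.ratio_pos hθ hα.1 x))

/-- Scheffé's argument: both densities have mass one, so the `L¹` distance is twice the integral of
the positive part of `p_{θ₀} - p_{a k}`, which is dominated by `p_{θ₀}`. -/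
theorem tendsto_integral_abs_sub_density {a : ℕ → Param d} (ha : ∀ k, a k ∈ M.Θ)
    (hθ₀ : θ₀ ∈ M.Θ)
    (hlim : ∀ᵐ x ∂M.dom, Tendsto (fun k => M.p (a k) x) atTop (𝓝 (M.p θ₀ x))) :
    Tendsto (fun k => ∫ x, |M.p (a k) x - M.p θ₀ x| ∂M.dom) atTop (𝓝 0) := by
  have hi : ∀ k, Integrable (fun x => max (M.p θ₀ x - M.p (a k) x) 0) M.dom := fun k =>
    ((Model.integrable_density hθ₀).sub (Model.integrable_density (ha k))).pos_part
  have h1 : ∀ k, ∫ x, |M.p (a k) x - M.p θ₀ x| ∂M.dom =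
      2 * ∫ x, max (M.p θ₀ x - M.p (a k) x) 0 ∂M.dom := by
    intro k
    have e : (fun x => |M.p (a k) x - M.p θ₀ x|) = fun x => (M.p (a k) x - M.p θ₀ x) +
        2 * max (M.p θ₀ x - M.p (a k) x) 0 := by
      funext x
      rcases le_total (M.p (a k) x) (M.p θ₀ x) with h | h
      · rw [abs_of_nonpos (by linarith), max_eq_left (by linarith)]; ring
      · rw [abs_of_nonneg (by linarith), max_eq_right (by linarith)]; ring
    have hs : Integrable (fun x => M.p (a k) x - M.p θ₀ x) M.dom :=
      (Model.integrable_density (ha k)).sub (Model.integrable_density hθ₀)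
    rw [e, integral_add hs ((hi k).const_mul 2), integral_const_mul,
      integral_sub (Model.integrable_density (ha k)) (Model.integrable_density hθ₀),
      Model.integral_density (ha k), Model.integral_density hθ₀]
    ring
  have h2 : Tendsto (fun k => ∫ x, max (M.p θ₀ x - M.p (a k) x) 0 ∂M.dom) atTop
      (𝓝 (∫ _x, (0 : ℝ) ∂M.dom)) := by
    refine tendsto_integral_of_dominated_convergence (M.p θ₀) (fun k => (hi k).1)
      (Model.integrable_density hθ₀) (fun k => ae_of_all _ fun x => ?_) ?_
    · rw [Real.norm_eq_abs, abs_of_nonneg (le_max_right _ _)]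
      exact max_le (by linarith [M.p_pos _ (ha k) x]) (M.p_pos _ hθ₀ x).le
    · filter_upwards [hlim] with x hx
      simpa using (tendsto_const_nhds (x := M.p θ₀ x)).sub hx |>.max
        (tendsto_const_nhds (x := (0 : ℝ)))
  simp_rw [h1]
  simpa using h2.const_mul 2

/-- Away from `θ₀` the criterion `P_{θ₀} h(θ, ·)` stays below its maximum. -/
theorem exists_integral_h_le_sub (hφ : IsDivergenceGenerator φ) (hθ : θ ∈ M.Θ)
    (hθ₀ : θ₀ ∈ finiteSet φ M θ)
    (hint : ∀ α ∈ finiteSet φ M θ, Integrable (dualIntegrand φ M θ α) M.dom)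
    (hh : ∀ α ∈ finiteSet φ M θ, Integrable (h φ M θ α) (M.law θ₀))
    (hsep : SeparatedFrom φ M θ θ₀) {δ : ℝ} (hδ : 0 < δ) :
    ∃ κ : ℝ, 0 < κ ∧ ∀ α ∈ finiteSet φ M θ, δ ≤ ‖α - θ₀‖ →
      ∫ x, h φ M θ α x ∂(M.law θ₀) ≤ ∫ x, h φ M θ θ₀ x ∂(M.law θ₀) - κ := by
  by_contra! hcon
  choose a ha hδa hlt using fun k : ℕ => hcon (1 / ((k : ℝ) + 1)) (by positivity)
  obtain ⟨η, hη, hηle⟩ := hsep δ hδ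
  set g : ℕ → 𝒳 → ℝ := fun k x =>
    M.p θ₀ x * bregman φ (M.ratio θ θ₀ x) (M.ratio θ (a k) x) with hg
  have hgap := fun k => integral_h_gap hθ₀ (ha k) hint hh
  have hg0 : ∀ k x, 0 ≤ g k x := fun k x => mul_nonneg (M.p_pos θ₀ hθ₀.1 x).le
    (hφ.bregman_nonneg (Model.ratio_pos hθ hθ₀.1 x) (Model.ratio_pos hθ (ha k).1 x))
  have hlim : Tendsto (fun k => ∫ x, g k x ∂M.dom) atTop (𝓝 0) := by
    refine squeeze_zero (fun k => integral_nonneg (hg0 k)) (fun k => ?_)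
      tendsto_one_div_add_atTop_nhds_zero_nat
    rw [(hgap k).2]
    linarith [hlt k]
  -- Convergence in `L¹` gives convergence in measure, hence almost everywhere along a subsequence;
  -- there the Bregman terms force the ratios, and so the densities, to converge.
  have hmeas : TendstoInMeasure M.dom g atTop 0 := by
    refine tendstoInMeasure_of_tendsto_eLpNorm one_ne_zero (fun k => (hgap k).1.1)
      aestronglyMeasurable_zero ?_
    have : ∀ k, eLpNorm (g k - 0) 1 M.dom = ENNReal.ofReal (∫ x, g k x ∂M.dom) := by
      intro k
      rw [sub_zero, eLpNorm_one_eq_lintegral_enorm,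
        ofReal_integral_eq_lintegral_ofReal (hgap k).1 (ae_of_all _ (hg0 k))]
      exact lintegral_congr fun x => Real.enorm_of_nonneg (hg0 k x)
    simp_rw [this]
    simpa using ENNReal.tendsto_ofReal hlim
  obtain ⟨ns, -, hae⟩ := hmeas.exists_seq_tendsto_ae
  have hp : ∀ᵐ x ∂M.dom, Tendsto (fun k => M.p (a (ns k)) x) atTop (𝓝 (M.p θ₀ x)) := by
    filter_upwards [hae] with x hx
    have h0 := M.p_pos θ₀ hθ₀.1 x
    have hb : Tendsto (fun k => bregman φ (M.ratio θ θ₀ x) (M.ratio θ (a (ns k)) x)) atTop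
        (𝓝 0) := by
      have := hx.const_mul (M.p θ₀ x)⁻¹
      simpa [hg, h0.ne'] using this
    have hr := hφ.tendsto_of_bregman (Model.ratio_pos hθ hθ₀.1 x)
      (fun k => Model.ratio_pos hθ (ha (ns k)).1 x) hb
    have := (tendsto_const_nhds (x := M.p θ x)).div hr (Model.ratio_pos hθ hθ₀.1 x).ne'
    have hpθ := (M.p_pos θ hθ x).ne'
    simpa [Model.ratio, Pi.div_def, div_div_cancel₀ hpθ] using this
  have := tendsto_integral_abs_sub_density (fun k => (ha (ns k)).1) hθ₀.1 hp
  obtain ⟨k, hk⟩ := (this.eventually (gt_mem_nhds hη)).exists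
  exact absurd (hηle _ (ha (ns k)) (hδa (ns k))) (not_le.2 hk)

end Duality

/-! ### Positive definite forms and Gaussian integrals. -/

section QuadraticForm

variable {d : ℕ} {S : Matrix (Fin d) (Fin d) ℝ}

theorem quadForm_eq_sum (S : Matrix (Fin d) (Fin d) ℝ) (t : Param d) :
    quadForm S t = ∑ i, ∑ j, t i * t j * S i j := by
  simp only [quadForm, dotProduct, Matrix.mulVec, Finset.mul_sum]
  exact Finset.sum_congr rfl fun i _ => Finset.sum_congr rfl fun j _ => by ring

theorem continuous_quadForm (S : Matrix (Fin d) (Fin d) ℝ) : Continuous (quadForm S) := by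
  have : quadForm S = fun t => ∑ i, ∑ j, t i * t j * S i j := funext (quadForm_eq_sum S)
  rw [this]
  fun_prop

theorem quadForm_smul (S : Matrix (Fin d) (Fin d) ℝ) (c : ℝ) (t : Param d) :
    quadForm S (c • t) = c ^ 2 * quadForm S t := by
  simp only [quadForm_eq_sum, Finset.mul_sum]
  exact Finset.sum_congr rfl fun i _ => Finset.sum_congr rfl fun j _ => by simp; ring

theorem quadForm_pos (hS : S.PosDef) {t : Param d} (ht : t ≠ 0) : 0 < quadForm S t := by
  have h0 : t.ofLp ≠ 0 := fun h => ht (by ext i; simp [h])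
  simpa [quadForm] using hS.dotProduct_mulVec_pos h0

theorem quadForm_nonneg (hS : S.PosDef) (t : Param d) : 0 ≤ quadForm S t := by
  rcases eq_or_ne t 0 with rfl | h
  · simp [quadForm]
  · exact (quadForm_pos hS h).le

theorem exists_mul_norm_sq_le_quadForm (hS : S.PosDef) :
    ∃ c : ℝ, 0 < c ∧ ∀ t : Param d, c * ‖t‖ ^ 2 ≤ quadForm S t := by
  -- The constant is the minimum of the form on the unit sphere, which is empty when `d = 0`.
  rcases (Metric.sphere (0 : Param d) 1).eq_empty_or_nonempty with he | hne
  · refine ⟨1, one_pos, fun t => ?_⟩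
    have ht : t = 0 := by
      by_contra h
      have : ‖t‖⁻¹ • t ∈ Metric.sphere (0 : Param d) 1 := by
        simp [norm_smul, h]
      rw [he] at this
      exact this
    subst ht
    simp [quadForm]
  · obtain ⟨u, hu, hmin⟩ := (isCompact_sphere (0 : Param d) 1).exists_isMinOn hne
      (continuous_quadForm S).continuousOn
    have hu0 : u ≠ 0 := by
      rintro rfl
      simp at hu
    refine ⟨quadForm S u, quadForm_pos hS hu0, fun t => ?_⟩
    rcases eq_or_ne t 0 with rfl | h
    · simp [quadForm]
    · have h1 : quadForm S u ≤ quadForm S (‖t‖⁻¹ • t) := hmin (by simp [norm_smul, h])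
      rw [quadForm_smul] at h1
      have hn : 0 < ‖t‖ := norm_pos_iff.2 h
      rw [inv_pow, inv_mul_eq_div, le_div_iff₀ (by positivity)] at h1
      exact h1

open scoped MatrixOrder Matrix.Norms.L2Operator in
-- A factorization `S = Bᵀ B` reduces the Gaussian integral to the standard one by a linear change
-- of variables.
theorem exists_quadForm_eq_norm_sq (hS : S.PosDef) : ∃ B : Matrix (Fin d) (Fin d) ℝ,
    B.det ^ 2 = S.det ∧ ∀ t : Param d, quadForm S t = ‖Matrix.toLpLin 2 2 B t‖ ^ 2 := by
  obtain ⟨B, rfl⟩ := CStarAlgebra.nonneg_iff_eq_star_mul_self.mp hS.posSemidef.nonneg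
  refine ⟨B, ?_, fun t => ?_⟩
  · rw [Matrix.det_mul, Matrix.star_eq_conjTranspose, Matrix.det_conjTranspose]
    simp [sq]
  · rw [EuclideanSpace.real_norm_sq_eq, quadForm, ← Matrix.mulVec_mulVec,
      Matrix.star_eq_conjTranspose, Matrix.conjTranspose_eq_transpose_of_trivial,
      Matrix.mulVec_transpose, dotProduct_comm, ← Matrix.dotProduct_mulVec]
    simp [dotProduct, Matrix.toLpLin_apply, sq]

theorem integrable_exp_neg_mul_norm_sq {b : ℝ} (hb : 0 < b) :
    Integrable fun t : Param d => Real.exp (-b * ‖t‖ ^ 2) := by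
  -- The Bochner integral of a nonintegrable function is `0`, so a nonzero value proves
  -- integrability.
  refine Integrable.of_integral_ne_zero ?_
  rw [GaussianFourier.integral_rexp_neg_mul_sq_norm hb]
  positivity

theorem integral_exp_quadForm (hS : S.PosDef) :
    ∫ t : Param d, Real.exp (-(1 / 2) * quadForm S t) = √((2 * Real.pi) ^ d / S.det) := by
  obtain ⟨B, hB, hq⟩ := exists_quadForm_eq_norm_sq hS
  have hdet : B.det ≠ 0 := by
    intro h
    have := hS.det_pos
    rw [← hB, h] at this
    simp at this
  have hdet' : LinearMap.det (Matrix.toLpLin 2 2 B) ≠ 0 := by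
    rwa [LinearMap.det_toLpLin]
  simp_rw [hq]
  have hc : Continuous (Matrix.toLpLin 2 2 B : Param d →ₗ[ℝ] Param d) :=
    LinearMap.continuous_of_finiteDimensional _
  have hmap := integral_map (μ := (volume : Measure (Param d))) hc.measurable.aemeasurable
    (f := fun u : Param d => Real.exp (-(1 / 2) * ‖u‖ ^ 2))
    (by fun_prop : Continuous _).aestronglyMeasurable
  rw [← hmap, Measure.map_linearMap_addHaar_eq_smul_addHaar _ hdet', integral_smul_measure,
    GaussianFourier.integral_rexp_neg_mul_sq_norm (by norm_num), ← hB, LinearMap.det_toLpLin,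
    ENNReal.toReal_ofReal (abs_nonneg _), Real.sqrt_div' _ (sq_nonneg _), Real.sqrt_sq_eq_abs,
    abs_inv, finrank_euclideanSpace_fin, smul_eq_mul, inv_mul_eq_div]
  congr 1
  rw [Real.sqrt_eq_rpow, ← Real.rpow_natCast, ← Real.rpow_mul (by positivity)]
  congr 1 <;> ring

theorem integrable_exp_quadForm (hS : S.PosDef) :
    Integrable fun t : Param d => Real.exp (-(1 / 2) * quadForm S t) := by
  refine Integrable.of_integral_ne_zero ?_
  rw [integral_exp_quadForm hS]
  have := hS.det_pos
  positivity

theorem gaussianDensity_eq (hS : S.PosDef) (t : Param d) :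
    gaussianDensity S t = Real.exp (-(1 / 2) * quadForm S t) /
      ∫ u : Param d, Real.exp (-(1 / 2) * quadForm S u) := by
  rw [integral_exp_quadForm hS, gaussianDensity, div_eq_inv_mul (Real.exp _),
    ← Real.sqrt_inv, inv_div]

end QuadraticForm

/-! ### Law of large numbers and Chebyshev bound. -/

section EmpiricalMeans

variable {𝒳 Ω : Type*} [MeasurableSpace 𝒳] [MeasurableSpace Ω] {μ : Measure Ω} {ν : Measure 𝒳}
  {X : ℕ → Ω → 𝒳} {f : 𝒳 → ℝ}

theorem identDistrib_comp (hX : ∀ i, Measurable (X i)) (hlaw : ∀ i, μ.map (X i) = ν)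
    (hf : AEMeasurable f ν) (i : ℕ) : IdentDistrib (f ∘ X i) f μ ν := by
  have h1 : IdentDistrib (X i) id μ ν := ⟨(hX i).aemeasurable, aemeasurable_id, by simp [hlaw i]⟩
  have := h1.comp_of_aemeasurable (u := f) (by rwa [hlaw i])
  simpa using this

theorem indepFun_comp (hX : ∀ i, Measurable (X i)) (hindep : iIndepFun X μ)
    (hlaw : ∀ i, μ.map (X i) = ν) (hf : AEMeasurable f ν) {i j : ℕ} (hij : i ≠ j) :
    IndepFun (f ∘ X i) (f ∘ X j) μ :=
  (hindep.indepFun hij).comp₀ (hX i).aemeasurable (hX j).aemeasurable (by rwa [hlaw i])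
    (by rwa [hlaw j])

theorem tendsto_empMean (hX : ∀ i, Measurable (X i)) (hindep : iIndepFun X μ)
    (hlaw : ∀ i, μ.map (X i) = ν) (hf : Integrable f ν) :
    ∀ᵐ ω ∂μ, Tendsto (fun n => empMean X n ω f) atTop (𝓝 (∫ x, f x ∂ν)) := by
  have hfm := hf.1.aemeasurable
  have hid := identDistrib_comp hX hlaw hfm
  have := strong_law_ae_real (fun i => f ∘ X i) ((hid 0).integrable_iff.2 hf)
    (fun i j hij => indepFun_comp hX hindep hlaw hfm hij) (fun i => (hid i).trans (hid 0).symm)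
  filter_upwards [this] with ω hω
  rw [(hid 0).integral_eq] at hω
  refine hω.congr fun n => ?_
  simp [empMean, div_eq_inv_mul]

/-- Chebyshev's inequality for the centred sum, whose variance is `n` times that of `f`. The bound
is free of `n`, which makes the normalized score tight. -/
theorem measure_le_sqrt_mul_abs_empMean [IsProbabilityMeasure μ] (hX : ∀ i, Measurable (X i))
    (hindep : iIndepFun X μ) (hlaw : ∀ i, μ.map (X i) = ν) (hf : MemLp f 2 ν)
    (hf0 : ∫ x, f x ∂ν = 0) {c : ℝ} (hc : 0 < c) {n : ℕ} (hn : n ≠ 0) :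
    μ {ω | c ≤ √n * |empMean X n ω f|} ≤ ENNReal.ofReal (variance f ν / c ^ 2) := by
  have hfm := hf.1.aemeasurable
  have hid := identDistrib_comp hX hlaw hfm
  have hL : ∀ i, MemLp (f ∘ X i) 2 μ := fun i => (hid i).memLp_iff.2 hf
  have hprob : IsProbabilityMeasure ν := by
    rw [← hlaw 0]; exact Measure.isProbabilityMeasure_map (hX 0).aemeasurable
  set Z : Ω → ℝ := ∑ i ∈ Finset.range n, f ∘ X i with hZ
  have hZL : MemLp Z 2 μ := memLp_finsetSum' _ fun i _ => hL i
  have hvar : variance Z μ = n * variance f ν := by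
    rw [hZ, IndepFun.variance_sum (fun i _ => hL i)
      (fun i _ j _ hij => indepFun_comp hX hindep hlaw hfm hij)]
    simp [(hid _).variance_eq]
  have hmean : ∫ ω, Z ω ∂μ = 0 := by
    simp only [hZ, Finset.sum_apply]
    rw [integral_finsetSum _ fun i _ => (hL i).integrable (by norm_num)]
    exact Finset.sum_eq_zero fun i _ => by rw [(hid i).integral_eq, hf0]
  have hn0 : (0 : ℝ) < n := by positivity
  have hsq : √(n : ℝ) * √n = n := Real.mul_self_sqrt hn0.le
  have hs0 : 0 < √(n : ℝ) := Real.sqrt_pos.2 hn0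
  have hch := meas_ge_le_variance_div_sq hZL (c := c * √n) (by positivity)
  rw [hmean, hvar, mul_pow, Real.sq_sqrt hn0.le, mul_comm (c ^ 2), mul_div_mul_left _ _ hn0.ne']
    at hch
  refine le_trans (measure_mono fun ω hω => ?_) hch
  simp only [mem_ofPred_eq, sub_zero] at hω ⊢
  have he : empMean X n ω f = (n : ℝ)⁻¹ * Z ω := by simp [empMean, hZ]
  rw [he, abs_mul, abs_inv, abs_of_pos hn0] at hω
  calc c * √n ≤ √n * ((n : ℝ)⁻¹ * |Z ω|) * √n := by gcongr
    _ = (√n * √n) * (n : ℝ)⁻¹ * |Z ω| := by ring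
    _ = |Z ω| := by rw [hsq, mul_inv_cancel₀ hn0.ne', one_mul]

end EmpiricalMeans

/-! ### Second-order behaviour of the population criterion. -/

section Population

variable {d : ℕ} {𝒳 : Type*} [MeasurableSpace 𝒳] {φ : ℝ → ℝ} {M : Model d 𝒳}
  {θ θ₀ : Param d}

/-- A bound on the remainder of the second order Taylor expansion at `θ₀` of `f`, with partial
derivatives `g` and second partial derivatives `q`. -/
def TaylorBound (r : ℝ) (θ₀ : Param d) (f : Param d → ℝ) (g : Fin d → ℝ)
    (q : Matrix (Fin d) (Fin d) ℝ) (K : ℝ) : Prop :=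
  ∀ v : Param d, ‖v‖ < r →
    |f (θ₀ + v) - f θ₀ - ∑ i, v i * g i - 1 / 2 * quadForm q v| ≤ K * ‖v‖ ^ 3

/-- The neighbourhood in the regularity condition does not depend on `x`, so one radius serves
almost all observations and the bound can be integrated or averaged. -/
theorem CondR2.exists_taylorBound (R2 : CondR2 φ M θ θ₀) :
    ∃ r : ℝ, 0 < r ∧ (∀ v : Param d, ‖v‖ < r → θ₀ + v ∈ finiteSet φ M θ) ∧
      ∃ H : 𝒳 → ℝ, Integrable H (M.law θ₀) ∧ ∀ᵐ x ∂(M.law θ₀),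
        (∀ i j, hessH φ M θ θ₀ x i j = hessH φ M θ θ₀ x j i) ∧
        TaylorBound r θ₀ (fun α => h φ M θ α x) (gradH φ M θ θ₀ x) (hessH φ M θ θ₀ x) (H x) := by
  obtain ⟨N, hN, h0, hNU, -, H, hH, hae⟩ := R2
  obtain ⟨r, hr, hsub⟩ := exists_cube_subset hN h0
  refine ⟨r, hr, fun v hv => hNU (hsub _ fun i => ?_), fun x => (d : ℝ) ^ 3 * H x,
    hH.const_mul _, ?_⟩
  · simpa using (abs_coord_le v i).trans_lt hv
  · filter_upwards [hae] with x hx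
    refine ⟨fun i j => pd_comm hN hx.1 hx.2 h0 i j, fun v hv => ?_⟩
    have := abs_taylor_two_le hN hx.1 hx.2 hsub hv
    rw [quadForm_eq_sum]
    exact this

theorem integral_quadForm {Q : 𝒳 → Matrix (Fin d) (Fin d) ℝ} {ν : Measure 𝒳}
    (hQ : ∀ i j, Integrable (fun x => Q x i j) ν) (v : Param d) :
    Integrable (fun x => quadForm (Q x) v) ν ∧
      ∫ x, quadForm (Q x) v ∂ν = quadForm (Matrix.of fun i j => ∫ x, Q x i j ∂ν) v := by
  simp only [quadForm_eq_sum, Matrix.of_apply]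
  refine ⟨integrable_finsetSum _ fun i _ => integrable_finsetSum _ fun j _ =>
    (hQ i j).const_mul _, ?_⟩
  rw [integral_finsetSum _ fun i _ => integrable_finsetSum _ fun j _ => (hQ i j).const_mul _]
  refine Finset.sum_congr rfl fun i _ => ?_
  rw [integral_finsetSum _ fun j _ => (hQ i j).const_mul _]
  exact Finset.sum_congr rfl fun j _ => integral_const_mul _ _

theorem quadForm_neg (S : Matrix (Fin d) (Fin d) ℝ) (v : Param d) :
    quadForm (-S) v = -quadForm S v := by
  simp [quadForm, Matrix.neg_mulVec]

theorem matS_eq_neg (φ : ℝ → ℝ) (M : Model d 𝒳) (θ θ₀ : Param d) :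
    matS φ M θ θ₀ = -Matrix.of fun i j => ∫ x, hessH φ M θ θ₀ x i j ∂(M.law θ₀) := by
  ext i j; simp [matS]

/-- Integrating the pointwise Taylor bound yields the second-order expansion of the population
criterion without differentiating under the integral sign. -/
theorem abs_integral_taylor_le (hθ₀ : θ₀ ∈ M.Θ) {r : ℝ} (hr : 0 < r)
    (hU : ∀ v : Param d, ‖v‖ < r → θ₀ + v ∈ finiteSet φ M θ) {H : 𝒳 → ℝ}
    (hH : Integrable H (M.law θ₀))
    (hT : ∀ᵐ x ∂(M.law θ₀),
      TaylorBound r θ₀ (fun α => h φ M θ α x) (gradH φ M θ θ₀ x) (hessH φ M θ θ₀ x) (H x))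
    (hh : ∀ α ∈ finiteSet φ M θ, Integrable (h φ M θ α) (M.law θ₀)) (R3 : CondR3 φ M θ θ₀) :
    TaylorBound r θ₀ (fun α => ∫ x, h φ M θ α x ∂(M.law θ₀))
      (fun i => ∫ x, gradH φ M θ θ₀ x i ∂(M.law θ₀)) (-matS φ M θ θ₀) (∫ x, H x ∂(M.law θ₀)) := by
  have := Model.isProbabilityMeasure_law (M := M) hθ₀
  intro v hv
  have hg : ∀ i, Integrable (fun x => v i * gradH φ M θ θ₀ x i) (M.law θ₀) := fun i =>
    ((R3.memLp_grad i).integrable (by norm_num)).const_mul _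
  have hgs : Integrable (fun x => ∑ i, v i * gradH φ M θ θ₀ x i) (M.law θ₀) :=
    integrable_finsetSum _ fun i _ => hg i
  obtain ⟨hq, hqe⟩ := integral_quadForm (fun i j => R3.integrable_hess i j) v
  have h0 : θ₀ ∈ finiteSet φ M θ := by simpa using hU 0 (by simpa using hr)
  have i1 := hh _ (hU v hv)
  have i2 := hh _ h0
  have i3 : Integrable (fun x => h φ M θ (θ₀ + v) x - h φ M θ θ₀ x) (M.law θ₀) := i1.sub i2
  have i4 : Integrable (fun x => h φ M θ (θ₀ + v) x - h φ M θ θ₀ x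
      - ∑ i, v i * gradH φ M θ θ₀ x i) (M.law θ₀) := i3.sub hgs
  have hgs_e : ∫ x, ∑ i, v i * gradH φ M θ θ₀ x i ∂(M.law θ₀) =
      ∑ i, v i * ∫ x, gradH φ M θ θ₀ x i ∂(M.law θ₀) := by
    rw [integral_finsetSum _ fun i _ => hg i]
    exact Finset.sum_congr rfl fun i _ => integral_const_mul _ _
  have heq : (∫ x, h φ M θ (θ₀ + v) x ∂(M.law θ₀)) - (∫ x, h φ M θ θ₀ x ∂(M.law θ₀))
      - (∑ i, v i * ∫ x, gradH φ M θ θ₀ x i ∂(M.law θ₀))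
      - 1 / 2 * quadForm (-matS φ M θ θ₀) v =
      ∫ x, (h φ M θ (θ₀ + v) x - h φ M θ θ₀ x - ∑ i, v i * gradH φ M θ θ₀ x i
        - 1 / 2 * quadForm (hessH φ M θ θ₀ x) v) ∂(M.law θ₀) := by
    rw [integral_sub i4 (hq.const_mul _), integral_const_mul, hqe,
      integral_sub i3 hgs, integral_sub i1 i2, hgs_e, matS_eq_neg, neg_neg]
  show |_| ≤ _
  rw [heq, ← integral_mul_const]
  refine (abs_integral_le_integral_abs).trans (integral_mono_ae ?_ (hH.mul_const _) ?_)
  · exact (i4.sub (hq.const_mul _)).abs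
  · filter_upwards [hT] with x hx using hx v hv

/-- Divide by `|s|` and let `s` tend to `0` from either side. -/
theorem eq_zero_of_mul_le_cube {r m A C : ℝ} (hr : 0 < r)
    (hle : ∀ s : ℝ, |s| < r → s * m ≤ A * s ^ 2 + C * |s| ^ 3) : m = 0 := by
  have hlim : Tendsto (fun s : ℝ => A * s + C * s ^ 2) (𝓝[>] 0) (𝓝 0) := by
    have : Continuous fun s : ℝ => A * s + C * s ^ 2 := by fun_prop
    simpa using (this.tendsto 0).mono_left nhdsWithin_le_nhds
  have hev : ∀ᶠ s : ℝ in 𝓝[>] 0, 0 < s ∧ s < r := Ioo_mem_nhdsGT hr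
  apply le_antisymm
  · refine ge_of_tendsto hlim ?_
    filter_upwards [hev] with s hs
    have := hle s (by rw [abs_of_pos hs.1]; exact hs.2)
    rw [abs_of_pos hs.1] at this
    refine le_of_mul_le_mul_left ?_ hs.1
    linarith
  · rw [← neg_nonpos]
    refine ge_of_tendsto hlim ?_
    filter_upwards [hev] with s hs
    have := hle (-s) (by rw [abs_neg, abs_of_pos hs.1]; exact hs.2)
    rw [abs_neg, abs_of_pos hs.1] at this
    refine le_of_mul_le_mul_left ?_ hs.1
    linarith

/-- At an interior maximum the gradient vanishes and the second order form is nonpositive. -/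
theorem TaylorBound.of_isMax {r : ℝ} (hr : 0 < r) {f : Param d → ℝ} {g : Fin d → ℝ}
    {q : Matrix (Fin d) (Fin d) ℝ} {K : ℝ} (hT : TaylorBound r θ₀ f g q K)
    (hmax : ∀ v : Param d, ‖v‖ < r → f (θ₀ + v) ≤ f θ₀) :
    (∀ i, g i = 0) ∧ ∀ v, quadForm q v ≤ 0 := by
  have key : ∀ v : Param d, ‖v‖ < r →
      ∑ i, v i * g i + 1 / 2 * quadForm q v ≤ K * ‖v‖ ^ 3 := by
    intro v hv
    have := (abs_le.1 (hT v hv)).1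
    linarith [hmax v hv]
  have hg : ∀ i, g i = 0 := by
    intro i
    refine eq_zero_of_mul_le_cube (r := r) (m := g i) (A := -(1 / 2) * q i i) (C := K) hr
      fun s hs => ?_
    have := key (s • EuclideanSpace.single i 1) (by simpa [norm_smul] using hs)
    rw [quadForm_smul] at this
    simp [norm_smul, quadForm] at this
    linarith
  -- With the gradient gone, evaluate at `s • v`, divide by `s ^ 2` and let `s` decrease to `0`.
  refine ⟨hg, fun v => ?_⟩
  have hlim : Tendsto (fun s : ℝ => 2 * K * s * ‖v‖ ^ 3) (𝓝[>] 0) (𝓝 0) := by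
    have : Continuous fun s : ℝ => 2 * K * s * ‖v‖ ^ 3 := by fun_prop
    simpa using (this.tendsto 0).mono_left nhdsWithin_le_nhds
  refine ge_of_tendsto hlim ?_
  have hev : ∀ᶠ s : ℝ in 𝓝[>] 0, 0 < s ∧ s < r / (‖v‖ + 1) := Ioo_mem_nhdsGT (by positivity)
  filter_upwards [hev] with s hs
  have hsv : ‖s • v‖ < r := by
    rw [norm_smul, Real.norm_eq_abs, abs_of_pos hs.1]
    have := (lt_div_iff₀ (by positivity)).1 hs.2
    nlinarith [hs.1]
  have := key (s • v) hsv
  rw [quadForm_smul, norm_smul, Real.norm_eq_abs, abs_of_pos hs.1] at this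
  simp only [hg, mul_zero, Finset.sum_const_zero, zero_add] at this
  have h2 : 0 < s ^ 2 := pow_pos hs.1 2
  refine le_of_mul_le_mul_left ?_ h2
  nlinarith

theorem posDef_of_quadForm_nonneg {S : Matrix (Fin d) (Fin d) ℝ} (hsymm : ∀ i j, S i j = S j i)
    (hS : ∀ v, 0 ≤ quadForm S v) (hdet : S.det ≠ 0) : S.PosDef := by
  have hpsd : S.PosSemidef := by
    refine .of_dotProduct_mulVec_nonneg ?_ fun x => ?_
    · ext i j
      simp [hsymm i j]
    · simpa [quadForm] using hS (WithLp.toLp 2 x)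
  exact hpsd.posDef_iff_det_ne_zero.2 hdet

end Population

/-! ### Normalization in `L¹`. -/

section Normalization

/-- Convergence in `L¹` is preserved by normalization. -/
theorem tendsto_lintegral_normalized {E ι : Type*} [MeasurableSpace E] {μ : Measure E}
    {l : Filter ι} {W : ι → E → ℝ} {G : E → ℝ} (hW : ∀ᶠ n in l, AEStronglyMeasurable (W n) μ)
    (hG : Integrable G μ) (hG0 : ∫ t, G t ∂μ ≠ 0)
    (hlim : Tendsto (fun n => ∫⁻ t, ‖W n t - G t‖ₑ ∂μ) l (𝓝 0)) :
    Tendsto (fun n => ∫⁻ t, ‖W n t / (∫ s, W n s ∂μ) - G t / (∫ s, G s ∂μ)‖ₑ ∂μ) l (𝓝 0) := by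
  have hWi : ∀ᶠ n in l, Integrable (W n) μ := by
    filter_upwards [hW, hlim.eventually (gt_mem_nhds ENNReal.zero_lt_top)] with n hn hfin
    have : Integrable (fun t => W n t - G t) μ := ⟨hn.sub hG.1, hfin⟩
    exact (this.add hG).congr (ae_of_all _ fun t => by simp)
  have hI := tendsto_integral_of_L1 G hG.1 hWi hlim
  have hinv := hI.inv₀ hG0
  set I := ∫ t, G t ∂μ
  -- With `J = ∫ W` and `I = ∫ G`, the difference `W/J - G/I` splits as `J⁻¹ (W - G) + (J⁻¹ - I⁻¹)
  -- G`; `h1` and `h2` treat the two terms.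
  have h1 : Tendsto (fun n => ‖(∫ t, W n t ∂μ)⁻¹‖ₑ * ∫⁻ t, ‖W n t - G t‖ₑ ∂μ) l (𝓝 0) := by
    have := ENNReal.Tendsto.mul hinv.enorm (Or.inr ENNReal.zero_ne_top) hlim
      (Or.inr enorm_ne_top)
    simpa using this
  have h2 : Tendsto (fun n => ‖(∫ t, W n t ∂μ)⁻¹ - I⁻¹‖ₑ * ∫⁻ t, ‖G t‖ₑ ∂μ) l (𝓝 0) := by
    have := ENNReal.Tendsto.mul_const (b := ∫⁻ t, ‖G t‖ₑ ∂μ) (hinv.sub_const I⁻¹).enorm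
      (Or.inr hG.2.ne)
    simpa using this
  have h3 := h1.add h2
  rw [add_zero] at h3
  refine tendsto_of_tendsto_of_tendsto_of_le_of_le' tendsto_const_nhds h3
    (Eventually.of_forall fun _ => zero_le) ?_
  filter_upwards [hW] with n hn
  have hm : AEMeasurable (fun t => ‖W n t - G t‖ₑ) μ := (hn.sub hG.1).enorm
  rw [← lintegral_const_mul'' _ hm, ← lintegral_const_mul'' _ hG.1.enorm,
    ← lintegral_add_left' (hm.const_mul _)]
  refine lintegral_mono fun t => ?_
  rw [← enorm_mul, ← enorm_mul]
  refine le_trans (le_of_eq ?_) (enorm_add_le _ _)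
  congr 1
  ring

end Normalization

/-! ### Affine rescaling of the parameter. -/

section ChangeOfVariables

variable {d : ℕ}

theorem lintegral_comp_smul_add {f : Param d → ℝ≥0∞} {s : ℝ} (hs : 0 < s)
    (b : Param d) : ∫⁻ t, f (s⁻¹ • t + b) = ENNReal.ofReal (s ^ d) * ∫⁻ t, f t := by
  have h1 : ∫⁻ t : Param d, f (s⁻¹ • t + b) =
      ∫⁻ t, f (t + b) ∂(Measure.map (fun t : Param d => s⁻¹ • t) volume) :=
    (lintegral_map_equiv (fun t => f (t + b))
      (Homeomorph.smul (isUnit_iff_ne_zero.2 (inv_ne_zero hs.ne')).unit).toMeasurableEquiv).symm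
  rw [h1, Measure.map_addHaar_smul _ (inv_ne_zero hs.ne'), lintegral_smul_measure,
    lintegral_add_right_eq_self, finrank_euclideanSpace_fin, smul_eq_mul, inv_pow, inv_inv,
    abs_of_pos (by positivity)]

theorem integral_comp_smul_add (f : Param d → ℝ) {s : ℝ} (hs : 0 < s) (b : Param d) :
    ∫ t, f (s⁻¹ • t + b) = s ^ d * ∫ t, f t := by
  rw [Measure.integral_comp_inv_smul_of_nonneg volume (fun t => f (t + b)) hs.le,
    integral_add_right_eq_self, finrank_euclideanSpace_fin, smul_eq_mul]

/-- Transports almost-everywhere measurability and almost-everywhere equalities to the local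
coordinate. -/
theorem quasiMeasurePreserving_smul_add {s : ℝ} (hs : 0 < s) (b : Param d) :
    Measure.QuasiMeasurePreserving (fun t : Param d => s⁻¹ • t + b) volume volume := by
  refine ⟨by fun_prop, ?_⟩
  intro A hA
  obtain ⟨B, hAB, hBm, hB⟩ := exists_measurable_superset_of_null hA
  refine measure_mono_null hAB ?_
  have hm : Measurable fun t : Param d => s⁻¹ • t + b := by fun_prop
  rw [← lintegral_indicator_one hBm, lintegral_map (measurable_one.indicator hBm) hm,
    lintegral_comp_smul_add hs, lintegral_indicator_one hBm, hB, mul_zero]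

end ChangeOfVariables

/-! ### Completing the square. -/

section Expansion

variable {d : ℕ} {S : Matrix (Fin d) (Fin d) ℝ}

theorem abs_quadForm_le (A : Matrix (Fin d) (Fin d) ℝ) (v : Param d) :
    |quadForm A v| ≤ (∑ i, ∑ j, |A i j|) * ‖v‖ ^ 2 := by
  rw [quadForm_eq_sum, Finset.sum_mul]
  refine (Finset.abs_sum_le_sum_abs _ _).trans (Finset.sum_le_sum fun i _ => ?_)
  rw [Finset.sum_mul]
  refine (Finset.abs_sum_le_sum_abs _ _).trans (Finset.sum_le_sum fun j _ => ?_)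
  rw [abs_mul, abs_mul, mul_comm, sq]
  have := abs_coord_le v i
  have := abs_coord_le v j
  gcongr

theorem quadForm_sub (hsymm : S.IsSymm) (v w : Param d) :
    quadForm S (v - w) = quadForm S v + quadForm S w - 2 * (v.ofLp ⬝ᵥ (S *ᵥ w.ofLp)) := by
  have h : w.ofLp ⬝ᵥ (S *ᵥ v.ofLp) = v.ofLp ⬝ᵥ (S *ᵥ w.ofLp) := by
    rw [Matrix.dotProduct_mulVec, dotProduct_comm, ← Matrix.mulVec_transpose, hsymm.eq]
  simp only [quadForm, WithLp.ofLp_sub, Matrix.mulVec_sub, dotProduct_sub, sub_dotProduct, h]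
  ring

theorem quadForm_add_matrix (A B : Matrix (Fin d) (Fin d) ℝ) (v : Param d) :
    quadForm (A + B) v = quadForm A v + quadForm B v := by
  simp [quadForm, Matrix.add_mulVec]

/-- The log-posterior around the centre is quadratic up to a controlled remainder. -/
theorem TaylorBound.abs_sub_quadratic_le (hsymm : S.IsSymm) {r K : ℝ} {θ₀ w : Param d}
    {f : Param d → ℝ} {g : Fin d → ℝ} {Q : Matrix (Fin d) (Fin d) ℝ}
    (hT : TaylorBound r θ₀ f g Q K) (hg : g = S *ᵥ w.ofLp) {v : Param d} (hv : ‖v‖ < r) :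
    |f (θ₀ + v) - f θ₀ - 1 / 2 * quadForm S w + 1 / 2 * quadForm S (v - w)| ≤
      ((∑ i, ∑ j, |(Q + S) i j|) / 2 + K * ‖v‖) * ‖v‖ ^ 2 := by
  have h1 := hT v hv
  have h2 := abs_quadForm_le (Q + S) v
  have h3 : ∑ i, v i * g i = v.ofLp ⬝ᵥ (S *ᵥ w.ofLp) := by rw [hg]; rfl
  rw [h3] at h1
  -- Since the gradient is `S w`, the linear term is the cross term of `quadForm S (v - w)`. Only
  -- the Hessian error `Q + S` and the cubic remainder survive.
  rw [quadForm_sub hsymm]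
  rw [quadForm_add_matrix] at h2
  calc _ = |(f (θ₀ + v) - f θ₀ - v.ofLp ⬝ᵥ (S *ᵥ w.ofLp) - 1 / 2 * quadForm Q v)
        + 1 / 2 * (quadForm Q v + quadForm S v)| := by congr 1; ring
    _ ≤ K * ‖v‖ ^ 3 + 1 / 2 * ((∑ i, ∑ j, |(Q + S) i j|) * ‖v‖ ^ 2) := by
        refine (abs_add_le _ _).trans (add_le_add h1 ?_)
        rw [abs_mul, abs_of_pos (by norm_num : (0 : ℝ) < 1 / 2)]
        gcongr
    _ = _ := by ring

end Expansion

/-! ### Laplace's method in the local coordinate. -/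

section LocalAsymptotics

variable {d : ℕ} {S : Matrix (Fin d) (Fin d) ℝ} {U : Set (Param d)} {prior : Param d → ℝ}
  {θ₀ : Param d}

/-- The weight `exp(n L(α)) π(α)`, carried by `U`, in the local coordinate `t = √n (α - θ₀ - w)`,
normalized to be close to `π(θ₀) exp(-tᵀ S t / 2)`. -/
def localWeight (S : Matrix (Fin d) (Fin d) ℝ) (U : Set (Param d)) (prior : Param d → ℝ)
    (θ₀ : Param d) (L : Param d → ℝ) (w : Param d) (n : ℕ) (t : Param d) : ℝ :=
  Real.exp (-(n * L θ₀) - n * (1 / 2 * quadForm S w)) *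
    U.indicator (fun α => Real.exp (n * L α) * prior α) ((√(n : ℝ))⁻¹ • t + (θ₀ + w))

theorem localWeight_eq {L : Param d → ℝ} {w t : Param d} {n : ℕ} (hn : n ≠ 0)
    (hU : θ₀ + ((√(n : ℝ))⁻¹ • t + w) ∈ U) :
    localWeight S U prior θ₀ L w n t = Real.exp (-(1 / 2) * quadForm S t +
      n * (L (θ₀ + ((√(n : ℝ))⁻¹ • t + w)) - L θ₀ - 1 / 2 * quadForm S w +
        1 / 2 * quadForm S (((√(n : ℝ))⁻¹ • t + w) - w))) *
      prior (θ₀ + ((√(n : ℝ))⁻¹ • t + w)) := by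
  have ha : (√(n : ℝ))⁻¹ • t + (θ₀ + w) = θ₀ + ((√(n : ℝ))⁻¹ • t + w) := by abel
  have hn0 : (0 : ℝ) < n := by positivity
  rw [localWeight, ha, indicator_of_mem hU, ← mul_assoc, ← Real.exp_add, add_sub_cancel_right,
    quadForm_smul, inv_pow, Real.sq_sqrt hn0.le]
  congr 2
  field_simp
  ring

theorem mul_norm_sq_le {w t : Param d} {n : ℕ} {B : ℝ} (hn : n ≠ 0) (hw : √(n : ℝ) * ‖w‖ ≤ B) :
    n * ‖(√(n : ℝ))⁻¹ • t + w‖ ^ 2 ≤ 2 * B ^ 2 + 2 * ‖t‖ ^ 2 := by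
  have hn0 : (0 : ℝ) < n := by positivity
  have hs0 : 0 < √(n : ℝ) := Real.sqrt_pos.2 hn0
  have h1 : √(n : ℝ) * ‖(√(n : ℝ))⁻¹ • t + w‖ ≤ ‖t‖ + B := by
    calc √(n : ℝ) * ‖(√(n : ℝ))⁻¹ • t + w‖ ≤ √(n : ℝ) * ((√(n : ℝ))⁻¹ * ‖t‖ + ‖w‖) := by
          gcongr
          refine (norm_add_le _ _).trans ?_
          rw [norm_smul, norm_inv, Real.norm_of_nonneg hs0.le]
      _ = ‖t‖ + √(n : ℝ) * ‖w‖ := by field_simp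
      _ ≤ _ := by gcongr
  have h2 : n * ‖(√(n : ℝ))⁻¹ • t + w‖ ^ 2 = (√(n : ℝ) * ‖(√(n : ℝ))⁻¹ • t + w‖) ^ 2 := by
    rw [mul_pow, Real.sq_sqrt hn0.le]
  rw [h2]
  have h3 : (√(n : ℝ) * ‖(√(n : ℝ))⁻¹ • t + w‖) ^ 2 ≤ (‖t‖ + B) ^ 2 := by gcongr
  nlinarith [sq_nonneg (‖t‖ - B)]

/-- The factor `n` is absorbed by `n ‖v‖ ^ 2`, which is of order `B ^ 2 + ‖t‖ ^ 2`. The bound `δ` is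
kept apart from `r`: a fixed `δ` gives domination, and `δ = ‖v‖` gives the pointwise limit. -/
theorem mul_abs_remainder_le (hsymm : S.IsSymm) {r K B δ : ℝ} {L : Param d → ℝ} {w t : Param d}
    {Q : Matrix (Fin d) (Fin d) ℝ} {n : ℕ} (hn : n ≠ 0)
    (hT : TaylorBound r θ₀ L (S *ᵥ w.ofLp) Q K) (hw : √(n : ℝ) * ‖w‖ ≤ B)
    (hr : ‖(√(n : ℝ))⁻¹ • t + w‖ < r) (hδ : ‖(√(n : ℝ))⁻¹ • t + w‖ ≤ δ) {Kb : ℝ} (hK : K ≤ Kb)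
    (hKb : 0 ≤ Kb) :
    |n * (L (θ₀ + ((√(n : ℝ))⁻¹ • t + w)) - L θ₀ - 1 / 2 * quadForm S w +
        1 / 2 * quadForm S (((√(n : ℝ))⁻¹ • t + w) - w))| ≤
      ((∑ i, ∑ j, |(Q + S) i j|) / 2 + Kb * δ) * (2 * B ^ 2 + 2 * ‖t‖ ^ 2) := by
  have h1 := hT.abs_sub_quadratic_le hsymm rfl hr
  have h2 := mul_norm_sq_le (t := t) hn hw
  set v := (√(n : ℝ))⁻¹ • t + w
  have hδ0 : 0 ≤ δ := (norm_nonneg v).trans hδ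
  have hs : 0 ≤ ∑ i, ∑ j, |(Q + S) i j| :=
    Finset.sum_nonneg fun i _ => Finset.sum_nonneg fun j _ => abs_nonneg _
  rw [abs_mul, Nat.abs_cast]
  calc _ ≤ n * (((∑ i, ∑ j, |(Q + S) i j|) / 2 + K * ‖v‖) * ‖v‖ ^ 2) := by gcongr
    _ ≤ n * (((∑ i, ∑ j, |(Q + S) i j|) / 2 + Kb * δ) * ‖v‖ ^ 2) := by gcongr
    _ = ((∑ i, ∑ j, |(Q + S) i j|) / 2 + Kb * δ) * (n * ‖v‖ ^ 2) := by ring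
    _ ≤ _ := by gcongr

theorem aestronglyMeasurable_localWeight (hU : MeasurableSet U)
    (hprior : AEStronglyMeasurable prior (volume.restrict U)) {L : Param d → ℝ}
    (hL : AEStronglyMeasurable L (volume.restrict U)) (w : Param d) {n : ℕ} (hn : n ≠ 0) :
    AEStronglyMeasurable (localWeight S U prior θ₀ L w n) volume := by
  have h1 : AEStronglyMeasurable (U.indicator fun α => Real.exp (n * L α) * prior α) volume := by
    rw [aestronglyMeasurable_indicator_iff hU]
    exact (Real.continuous_exp.comp_aestronglyMeasurable (hL.const_mul _)).mul hprior
  have hs : 0 < √(n : ℝ) := Real.sqrt_pos.2 (by positivity)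
  exact (h1.comp_quasiMeasurePreserving (quasiMeasurePreserving_smul_add hs _)).const_mul _

section Sequence

variable {l : Filter ℕ} {L : ℕ → Param d → ℝ} {w : ℕ → Param d} {B : ℝ}

theorem tendsto_inv_sqrt_smul_add (hl : l ≤ atTop) (hw : ∀ᶠ n : ℕ in l, √(n : ℝ) * ‖w n‖ ≤ B)
    (t : Param d) : Tendsto (fun n : ℕ => (√(n : ℝ))⁻¹ • t + w n) l (𝓝 0) := by
  have hinv : Tendsto (fun n : ℕ => (√(n : ℝ))⁻¹) l (𝓝 0) :=
    ((Real.tendsto_sqrt_atTop.comp tendsto_natCast_atTop_atTop).mono_left hl).inv_tendsto_atTop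
  have hw0 : Tendsto w l (𝓝 0) := by
    refine squeeze_zero_norm' ?_ (by simpa using hinv.mul_const B)
    filter_upwards [hw, hl (eventually_ne_atTop 0)] with n h1 hn
    have hs : 0 < √(n : ℝ) := Real.sqrt_pos.2 (by positivity)
    rw [inv_mul_eq_div, le_div_iff₀ hs, mul_comm]
    exact h1
  simpa using (hinv.smul_const t).add hw0

/-- Near `θ₀`, the local weight converges to the Gaussian weight. -/
theorem tendsto_lintegral_localWeight_inner [l.IsCountablyGenerated] (hl : l ≤ atTop)
    (hS : S.PosDef) (hU : MeasurableSet U) (hprior0 : ∀ α ∈ U, 0 ≤ prior α)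
    (hpriori : AEStronglyMeasurable prior (volume.restrict U)) (hpriorc : ContinuousAt prior θ₀)
    (hpriorp : 0 < prior θ₀) {r : ℝ} (hr : 0 < r) (hrU : ∀ v : Param d, ‖v‖ < r → θ₀ + v ∈ U)
    (hL : ∀ n, AEStronglyMeasurable (L n) (volume.restrict U))
    (hw : ∀ᶠ n : ℕ in l, √(n : ℝ) * ‖w n‖ ≤ B) {Q : ℕ → Matrix (Fin d) (Fin d) ℝ} {K : ℕ → ℝ}
    {K₀ : ℝ} (hT : ∀ n, TaylorBound r θ₀ (L n) (S *ᵥ (w n).ofLp) (Q n) (K n))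
    (hQ : ∀ i j, Tendsto (fun n => Q n i j) l (𝓝 (-S i j))) (hK : Tendsto K l (𝓝 K₀)) :
    ∃ δ : ℝ, 0 < δ ∧ Tendsto (fun n : ℕ => ∫⁻ t : Param d,
      ‖{t : Param d | ‖(√(n : ℝ))⁻¹ • t + w n‖ < δ}.indicator
          (localWeight S U prior θ₀ (L n) (w n) n) t -
        prior θ₀ * Real.exp (-(1 / 2) * quadForm S t)‖ₑ) l (𝓝 0) := by
  have hsymm : S.IsSymm := by
    have := hS.1; rwa [Matrix.IsHermitian, Matrix.conjTranspose_eq_transpose_of_trivial] at this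
  obtain ⟨c, hc, hcq⟩ := exists_mul_norm_sq_le_quadForm hS
  set Kb : ℝ := |K₀| + 1 with hKb
  have hKb0 : 0 < Kb := by positivity
  have hKev : ∀ᶠ n in l, K n ≤ Kb :=
    (hK.eventually (gt_mem_nhds (show K₀ < Kb by linarith [le_abs_self K₀]))).mono
      fun _ h => h.le
  have hρ : Tendsto (fun n => (∑ i, ∑ j, |(Q n + S) i j|) / 2) l (𝓝 0) := by
    have : Tendsto (fun n => (∑ i, ∑ j, |(Q n + S) i j|) / 2) l
        (𝓝 ((∑ i, ∑ j, |-S i j + S i j|) / 2)) :=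
      (tendsto_finsetSum _ fun i _ => tendsto_finsetSum _ fun j _ =>
        ((hQ i j).add_const (S i j)).abs).div_const 2
    simpa using this
  have hρev : ∀ᶠ n in l, (∑ i, ∑ j, |(Q n + S) i j|) / 2 ≤ c / 16 :=
    (hρ.eventually (gt_mem_nhds (by positivity))).mono fun _ h => h.le
  obtain ⟨δ₁, hδ₁, hδ₁p⟩ : ∃ δ₁ > 0, ∀ v : Param d, ‖v‖ < δ₁ → prior (θ₀ + v) ≤ 2 * prior θ₀ := by
    have := hpriorc.eventually (gt_mem_nhds (show prior θ₀ < 2 * prior θ₀ by linarith))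
    obtain ⟨δ₁, hδ₁, h⟩ := Metric.eventually_nhds_iff.1 this
    exact ⟨δ₁, hδ₁, fun v hv => (h (by simpa [dist_eq_norm] using hv)).le⟩
  -- The Hessian error and `Kb * δ` are each at most `c / 16`, so the remainder is at most `(c / 4)
  -- (B ^ 2 + ‖t‖ ^ 2)`. Half of the Gaussian decay `(c / 2) ‖t‖ ^ 2` is left, and `A` collects the
  -- constants.
  set δ : ℝ := min (min r δ₁) (c / 16 / Kb) with hδ
  have hδ0 : 0 < δ := by positivity
  have hδr : δ ≤ r := (min_le_left _ _).trans (min_le_left _ _)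
  have hδδ₁ : δ ≤ δ₁ := (min_le_left _ _).trans (min_le_right _ _)
  have hδc : Kb * δ ≤ c / 16 := by
    have : δ ≤ c / 16 / Kb := min_le_right _ _
    rw [le_div_iff₀ hKb0] at this
    linarith
  refine ⟨δ, hδ0, ?_⟩
  set A : ℝ := 2 * prior θ₀ * Real.exp (c / 4 * B ^ 2) with hA
  have hA0 : 0 < A := by positivity
  set G : Param d → ℝ := fun t => prior θ₀ * Real.exp (-(1 / 2) * quadForm S t) with hG
  have hGi : Integrable G := (integrable_exp_quadForm hS).const_mul _
  have hbi : Integrable fun t : Param d => A * Real.exp (-(c / 4) * ‖t‖ ^ 2) + G t :=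
    ((integrable_exp_neg_mul_norm_sq (by positivity)).const_mul _).add hGi
  have hG0 : ∀ t, 0 < G t := fun t => by positivity
  have hDCT := tendsto_lintegral_filter_of_dominated_convergence' (μ := (volume : Measure (Param d)))
    (l := l) (F := fun (n : ℕ) t => ‖{t : Param d | ‖(√(n : ℝ))⁻¹ • t + w n‖ < δ}.indicator
          (localWeight S U prior θ₀ (L n) (w n) n) t - G t‖ₑ) (f := fun _ => 0)
    (fun t => ‖A * Real.exp (-(c / 4) * ‖t‖ ^ 2) + G t‖ₑ) ?_ ?_ hbi.2.ne ?_
  · rw [lintegral_zero] at hDCT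
    exact hDCT
  · filter_upwards [hl (eventually_ne_atTop 0)] with n hn
    refine AEStronglyMeasurable.enorm (AEStronglyMeasurable.sub
      (AEStronglyMeasurable.indicator ?_ ?_) hGi.1)
    · exact aestronglyMeasurable_localWeight hU hpriori (hL n) (w n) hn
    · exact measurableSet_lt (by fun_prop) measurable_const
  · filter_upwards [hl (eventually_ne_atTop 0), hw, hKev, hρev] with n hn hwn hKn hρn
    refine ae_of_all _ fun t => ?_
    have hb : ‖A * Real.exp (-(c / 4) * ‖t‖ ^ 2) + G t‖ =
        A * Real.exp (-(c / 4) * ‖t‖ ^ 2) + G t :=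
      Real.norm_of_nonneg (add_nonneg (by positivity) (hG0 t).le)
    rw [enorm_le_iff_norm_le, hb]
    refine (norm_sub_le _ _).trans ?_
    rw [Real.norm_of_nonneg (hG0 t).le]
    gcongr
    by_cases ht : ‖(√(n : ℝ))⁻¹ • t + w n‖ < δ
    · rw [indicator_of_mem (show t ∈ {t : Param d | ‖(√(n : ℝ))⁻¹ • t + w n‖ < δ} from ht),
        localWeight_eq hn (hrU _ (ht.trans_le hδr))]
      have hrem := mul_abs_remainder_le hsymm hn (hT n) hwn (ht.trans_le hδr) ht.le hKn hKb0.le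
      have hcoef : ((∑ i, ∑ j, |(Q n + S) i j|) / 2 + Kb * δ) * (2 * B ^ 2 + 2 * ‖t‖ ^ 2) ≤
          c / 8 * (2 * B ^ 2 + 2 * ‖t‖ ^ 2) := by
        gcongr
        linarith
      have hp0 := hprior0 _ (hrU _ (ht.trans_le hδr))
      rw [Real.norm_of_nonneg (mul_nonneg (Real.exp_pos _).le hp0), mul_comm, hA, mul_assoc,
        ← Real.exp_add]
      refine mul_le_mul (hδ₁p _ (ht.trans_le hδδ₁)) (Real.exp_le_exp.2 ?_) (Real.exp_pos _).le
        (by positivity)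
      have h1 := hcq t
      have h2 := (le_abs_self _).trans hrem
      linarith
    · rw [indicator_of_notMem (show t ∉ {t : Param d | ‖(√(n : ℝ))⁻¹ • t + w n‖ < δ} from ht),
        norm_zero]
      positivity
  · refine ae_of_all _ fun t => ?_
    have hv := tendsto_inv_sqrt_smul_add hl hw t
    have hvn : Tendsto (fun n : ℕ => ‖(√(n : ℝ))⁻¹ • t + w n‖) l (𝓝 0) := by simpa using hv.norm
    have hrem : Tendsto (fun n : ℕ => (n : ℝ) * (L n (θ₀ + ((√(n : ℝ))⁻¹ • t + w n)) - L n θ₀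
        - 1 / 2 * quadForm S (w n) + 1 / 2 * quadForm S (((√(n : ℝ))⁻¹ • t + w n) - w n))) l
        (𝓝 0) := by
      have hb : Tendsto (fun n : ℕ => ((∑ i, ∑ j, |(Q n + S) i j|) / 2 +
          Kb * ‖(√(n : ℝ))⁻¹ • t + w n‖) * (2 * B ^ 2 + 2 * ‖t‖ ^ 2)) l (𝓝 0) := by
        simpa using (hρ.add (hvn.const_mul Kb)).mul_const (2 * B ^ 2 + 2 * ‖t‖ ^ 2)
      refine squeeze_zero_norm' ?_ hb
      filter_upwards [hl (eventually_ne_atTop 0), hw, hKev, hvn.eventually (gt_mem_nhds hr)]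
        with n hn hwn hKn hvr
      exact mul_abs_remainder_le hsymm hn (hT n) hwn hvr le_rfl hKn hKb0.le
    have hpl : Tendsto (fun n : ℕ => prior (θ₀ + ((√(n : ℝ))⁻¹ • t + w n))) l (𝓝 (prior θ₀)) := by
      refine hpriorc.tendsto.comp ?_
      simpa using hv.const_add θ₀
    have hlim := ((Real.continuous_exp.tendsto _).comp
      (hrem.const_add (-(1 / 2) * quadForm S t))).mul hpl
    rw [add_zero] at hlim
    have hF : Tendsto (fun n : ℕ => {t : Param d | ‖(√(n : ℝ))⁻¹ • t + w n‖ < δ}.indicator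
        (localWeight S U prior θ₀ (L n) (w n) n) t) l (𝓝 (G t)) := by
      rw [hG]
      simp only []
      rw [mul_comm]
      refine hlim.congr' ?_
      filter_upwards [hl (eventually_ne_atTop 0), hvn.eventually (gt_mem_nhds hδ0)] with n hn hvδ
      rw [indicator_of_mem (show t ∈ {t : Param d | ‖(√(n : ℝ))⁻¹ • t + w n‖ < δ} from hvδ),
        localWeight_eq hn (hrU _ (hvδ.trans_le hδr))]
      rfl
    have := (hF.sub_const (G t)).enorm
    simpa using this

/-- Away from `θ₀`, the local weight is negligible. -/
theorem tendsto_lintegral_localWeight_outer (hl : l ≤ atTop) (hS : S.PosDef)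
    (hU : MeasurableSet U) (hpriori : IntegrableOn prior U) {δ κ : ℝ} (hκ : 0 < κ)
    (hsep : ∀ᶠ n in l, ∀ α ∈ U, δ ≤ ‖α - θ₀‖ → L n α ≤ L n θ₀ - κ) :
    Tendsto (fun n : ℕ => ∫⁻ t : Param d,
      ‖{t : Param d | ‖(√(n : ℝ))⁻¹ • t + w n‖ < δ}ᶜ.indicator
          (localWeight S U prior θ₀ (L n) (w n) n) t‖ₑ) l (𝓝 0) := by
  -- The power of `√n` is the Jacobian of the rescaling; the exponential comes from the gap `κ`.
  have hexp : Tendsto (fun n : ℕ => Real.exp (-(n * κ)) * √(n : ℝ) ^ d) l (𝓝 0) := by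
    have h1 := tendsto_rpow_mul_exp_neg_mul_atTop_nhds_zero ((d : ℝ) / 2) κ hκ
    have h2 := (h1.comp tendsto_natCast_atTop_atTop).mono_left hl
    refine h2.congr fun n => ?_
    simp only [Function.comp_apply]
    rw [mul_comm, Real.sqrt_eq_rpow, ← Real.rpow_natCast, ← Real.rpow_mul (Nat.cast_nonneg _)]
    congr 2 <;> ring
  have hfin : ∫⁻ t, ‖U.indicator prior t‖ₑ ≠ ∞ :=
    ((integrable_indicator_iff hU).2 hpriori).2.ne
  have hlim : Tendsto (fun n : ℕ => ENNReal.ofReal (Real.exp (-(n * κ)) * √(n : ℝ) ^ d) *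
      ∫⁻ t, ‖U.indicator prior t‖ₑ) l (𝓝 0) := by
    have := ENNReal.Tendsto.mul_const (b := ∫⁻ t, ‖U.indicator prior t‖ₑ)
      (ENNReal.tendsto_ofReal hexp) (Or.inr hfin)
    simpa using this
  refine tendsto_of_tendsto_of_tendsto_of_le_of_le' tendsto_const_nhds hlim
    (Eventually.of_forall fun _ => zero_le) ?_
  filter_upwards [hsep, hl (eventually_ne_atTop 0)] with n hn hn0
  have hs : 0 < √(n : ℝ) := Real.sqrt_pos.2 (by positivity)
  rw [ENNReal.ofReal_mul (Real.exp_pos _).le, mul_assoc,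
    ← lintegral_comp_smul_add (f := fun t => ‖U.indicator prior t‖ₑ) hs (θ₀ + w n),
    ← lintegral_const_mul' _ _ ENNReal.ofReal_ne_top]
  refine lintegral_mono fun t => ?_
  by_cases ht : ‖(√(n : ℝ))⁻¹ • t + w n‖ < δ
  · rw [indicator_of_notMem (by simpa using ht)]
    simp
  rw [indicator_of_mem (by simpa using ht), localWeight]
  by_cases hα : (√(n : ℝ))⁻¹ • t + (θ₀ + w n) ∈ U
  · rw [indicator_of_mem hα, indicator_of_mem hα, ← mul_assoc, ← Real.exp_add, enorm_mul,
      Real.enorm_of_nonneg (Real.exp_pos _).le]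
    gcongr
    have h1 := hn _ hα (by
      have : (√(n : ℝ))⁻¹ • t + (θ₀ + w n) - θ₀ = (√(n : ℝ))⁻¹ • t + w n := by abel
      rw [this]; exact not_lt.1 ht)
    have h2 := quadForm_nonneg hS (w n)
    have h3 : (0 : ℝ) ≤ n := Nat.cast_nonneg _
    nlinarith [mul_le_mul_of_nonneg_left h1 h3, mul_nonneg h3 h2]
  · rw [indicator_of_notMem hα, indicator_of_notMem hα]
    simp

/-- The rescaled normalized weights converge in `L¹` to the Gaussian density with precision `S`. -/
theorem tendsto_lintegral_rescaled_sub_gaussian [l.IsCountablyGenerated] (hl : l ≤ atTop)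
    (hS : S.PosDef) (hU : MeasurableSet U) (hprior0 : ∀ α ∈ U, 0 ≤ prior α)
    (hpriori : IntegrableOn prior U) (hpriorc : ContinuousAt prior θ₀)
    (hpriorp : 0 < prior θ₀) {r : ℝ} (hr : 0 < r) (hrU : ∀ v : Param d, ‖v‖ < r → θ₀ + v ∈ U)
    (hL : ∀ n, AEStronglyMeasurable (L n) (volume.restrict U))
    (hw : ∀ᶠ n : ℕ in l, √(n : ℝ) * ‖w n‖ ≤ B) {Q : ℕ → Matrix (Fin d) (Fin d) ℝ} {K : ℕ → ℝ}
    {K₀ : ℝ} (hT : ∀ n, TaylorBound r θ₀ (L n) (S *ᵥ (w n).ofLp) (Q n) (K n))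
    (hQ : ∀ i j, Tendsto (fun n => Q n i j) l (𝓝 (-S i j))) (hK : Tendsto K l (𝓝 K₀))
    (hsep : ∀ δ : ℝ, 0 < δ → ∃ κ : ℝ, 0 < κ ∧
      ∀ᶠ n in l, ∀ α ∈ U, δ ≤ ‖α - θ₀‖ → L n α ≤ L n θ₀ - κ) :
    Tendsto (fun n : ℕ => ∫⁻ t : Param d, ‖(√(n : ℝ) ^ d)⁻¹ *
      (U.indicator (fun α => Real.exp (n * L n α) * prior α) ((√(n : ℝ))⁻¹ • t + (θ₀ + w n)) /
        ∫ β in U, Real.exp (n * L n β) * prior β) - gaussianDensity S t‖ₑ) l (𝓝 0) := by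
  obtain ⟨δ, hδ, hin⟩ := tendsto_lintegral_localWeight_inner hl hS hU hprior0 hpriori.1 hpriorc
    hpriorp hr hrU hL hw hT hQ hK
  obtain ⟨κ, hκ, hsepδ⟩ := hsep δ hδ
  have hout := tendsto_lintegral_localWeight_outer (w := w) hl hS hU hpriori hκ hsepδ
  have hsum := hin.add hout
  rw [add_zero] at hsum
  set G : Param d → ℝ := fun t => prior θ₀ * Real.exp (-(1 / 2) * quadForm S t) with hG
  have hGi : Integrable G := (integrable_exp_quadForm hS).const_mul _
  have hGint : ∫ t, G t = prior θ₀ * ∫ t : Param d, Real.exp (-(1 / 2) * quadForm S t) :=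
    integral_const_mul _ _
  have hG0 : ∫ t, G t ≠ 0 := by
    rw [hGint, integral_exp_quadForm hS]
    have := hS.det_pos
    positivity
  have hWm : ∀ᶠ n in l, AEStronglyMeasurable (localWeight S U prior θ₀ (L n) (w n) n) volume := by
    filter_upwards [hl (eventually_ne_atTop 0)] with n hn
    exact aestronglyMeasurable_localWeight hU hpriori.1 (hL n) (w n) hn
  have hWlim : Tendsto (fun n => ∫⁻ t, ‖localWeight S U prior θ₀ (L n) (w n) n t - G t‖ₑ) l
      (𝓝 0) := by
    refine tendsto_of_tendsto_of_tendsto_of_le_of_le' tendsto_const_nhds hsum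
      (Eventually.of_forall fun _ => zero_le) ?_
    filter_upwards [hWm] with n hn
    have hms : MeasurableSet {t : Param d | ‖(√(n : ℝ))⁻¹ • t + w n‖ < δ} :=
      measurableSet_lt (by fun_prop) measurable_const
    have hm : AEMeasurable (fun t => ‖{t : Param d | ‖(√(n : ℝ))⁻¹ • t + w n‖ < δ}.indicator
        (localWeight S U prior θ₀ (L n) (w n) n) t -
        prior θ₀ * Real.exp (-(1 / 2) * quadForm S t)‖ₑ) volume :=
      ((hn.indicator hms).sub hGi.1).enorm
    rw [← lintegral_add_left' hm]
    refine lintegral_mono fun t => ?_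
    refine le_trans (le_of_eq ?_) (enorm_add_le _ _)
    congr 1
    have := congrFun (indicator_self_add_compl {t : Param d | ‖(√(n : ℝ))⁻¹ • t + w n‖ < δ}
      (localWeight S U prior θ₀ (L n) (w n) n)) t
    rw [← this]
    simp only [Pi.add_apply, hG]
    ring
  refine (tendsto_lintegral_normalized hWm hGi hG0 hWlim).congr' ?_
  filter_upwards [hl (eventually_ne_atTop 0)] with n hn
  have hs : 0 < √(n : ℝ) := Real.sqrt_pos.2 (by positivity)
  -- The exponential prefactor of `localWeight` cancels in the quotient, and the Jacobian becomes
  -- the factor `(√n ^ d)⁻¹` of the rescaled density.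
  have hWint : ∫ t, localWeight S U prior θ₀ (L n) (w n) n t =
      Real.exp (-(n * L n θ₀) - n * (1 / 2 * quadForm S (w n))) * (√(n : ℝ) ^ d *
        ∫ β in U, Real.exp (n * L n β) * prior β) := by
    simp only [localWeight]
    rw [integral_const_mul, integral_comp_smul_add _ hs, integral_indicator hU]
  refine lintegral_congr fun t => ?_
  rw [hWint, hGint, gaussianDensity_eq hS, mul_div_mul_left _ _ hpriorp.ne', localWeight,
    mul_div_mul_left _ _ (Real.exp_pos _).ne', div_mul_eq_div_div_swap, inv_mul_eq_div]

end Sequence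

end LocalAsymptotics

/-! ### Application to the posterior. -/

section Posterior

variable {d : ℕ} {𝒳 Ω : Type*} [MeasurableSpace 𝒳] {φ : ℝ → ℝ} {M : Model d 𝒳}
  {θ θ₀ : Param d} {X : ℕ → Ω → 𝒳} {prior : Param d → ℝ}

theorem quadForm_empMean {𝒳 : Type*} {X : ℕ → Ω → 𝒳}
    (Q : 𝒳 → Matrix (Fin d) (Fin d) ℝ) (n : ℕ) (ω : Ω) (v : Param d) :
    quadForm (Matrix.of fun i j => empMean X n ω fun x => Q x i j) v =
      empMean X n ω fun x => quadForm (Q x) v := by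
  simp only [quadForm_eq_sum, empMean, Matrix.of_apply, Finset.mul_sum]
  rw [Finset.sum_comm' (t' := Finset.univ) (s' := fun _ => Finset.range n) (by simp)]
  refine Finset.sum_congr rfl fun i _ => ?_
  rw [Finset.sum_comm' (t' := Finset.univ) (s' := fun _ => Finset.range n) (by simp)]
  refine Finset.sum_congr rfl fun j _ => Finset.sum_congr rfl fun k _ => by ring

theorem TaylorBound.empMean {𝒳 : Type*} {X : ℕ → Ω → 𝒳} {r : ℝ}
    {f : Param d → 𝒳 → ℝ} {g : 𝒳 → Fin d → ℝ}
    {Q : 𝒳 → Matrix (Fin d) (Fin d) ℝ} {H : 𝒳 → ℝ} {ω : Ω}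
    (hT : ∀ k, TaylorBound r θ₀ (fun α => f α (X k ω)) (g (X k ω)) (Q (X k ω)) (H (X k ω)))
    (n : ℕ) :
    TaylorBound r θ₀ (fun α => empMean X n ω (f α))
      (fun i => PhiPosterior.empMean X n ω fun x => g x i)
      (Matrix.of fun i j => PhiPosterior.empMean X n ω fun x => Q x i j)
      (PhiPosterior.empMean X n ω H) := by
  intro v hv
  rw [quadForm_empMean]
  have h1 : ∑ i, v i * PhiPosterior.empMean X n ω (fun x => g x i) =
      PhiPosterior.empMean X n ω fun x => ∑ i, v i * g x i := by
    simp only [PhiPosterior.empMean, Finset.mul_sum]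
    rw [Finset.sum_comm]
    exact Finset.sum_congr rfl fun k _ => Finset.sum_congr rfl fun i _ => by ring
  rw [h1]
  simp only [PhiPosterior.empMean]
  have hn : (0 : ℝ) ≤ (n : ℝ)⁻¹ := by positivity
  calc _ = |(n : ℝ)⁻¹ * ∑ k ∈ Finset.range n, (f (θ₀ + v) (X k ω) - f θ₀ (X k ω)
        - ∑ i, v i * g (X k ω) i - 1 / 2 * quadForm (Q (X k ω)) v)| := by
        congr 1
        simp only [Finset.sum_sub_distrib, ← Finset.mul_sum]
        ring
    _ ≤ (n : ℝ)⁻¹ * ∑ k ∈ Finset.range n, H (X k ω) * ‖v‖ ^ 3 := by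
        rw [abs_mul, abs_of_nonneg hn]
        gcongr
        exact (Finset.abs_sum_le_sum_abs _ _).trans (Finset.sum_le_sum fun k _ => hT k v hv)
    _ = _ := by rw [← Finset.sum_mul, mul_assoc]

theorem norm_toLp_mulVec_le (A : Matrix (Fin d) (Fin d) ℝ) {u : Fin d → ℝ} {b : ℝ}
    (hu : ∀ i, |u i| ≤ b) :
    ‖(WithLp.toLp 2 (A *ᵥ u) : Param d)‖ ≤ (∑ i, ∑ j, |A i j|) * b := by
  have h1 : ‖(WithLp.toLp 2 (A *ᵥ u) : Param d)‖ ≤ ∑ i, |(A *ᵥ u) i| := by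
    have e : (WithLp.toLp 2 (A *ᵥ u) : Param d) =
        ∑ i, (A *ᵥ u) i • EuclideanSpace.single i (1 : ℝ) := by
      ext j; simp [Finset.sum_apply, Pi.single_apply]
    rw [e]
    refine (norm_sum_le _ _).trans (Finset.sum_le_sum fun i _ => ?_)
    simp [norm_smul]
  refine h1.trans ?_
  rw [Finset.sum_mul]
  refine Finset.sum_le_sum fun i _ => ?_
  rw [Finset.sum_mul]
  change |∑ j, A i j * u j| ≤ _
  refine (Finset.abs_sum_le_sum_abs _ _).trans (Finset.sum_le_sum fun j _ => ?_)
  rw [abs_mul]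
  gcongr
  exact hu j

variable [MeasurableSpace Ω] {μ : Measure Ω}

theorem measurable_empMean_hReg (hφ : IsDivergenceGenerator φ) (hX : ∀ i, Measurable (X i))
    (n : ℕ) : Measurable fun z : Ω × Param d => empMean X n z.1 (hReg φ M θ z.2) := by
  have hk : ∀ k, Measurable fun z : Ω × Param d => hReg φ M θ z.2 (X k z.1) := fun k =>
    (measurable_hReg hφ M θ).comp (f := fun z : Ω × Param d => (z.2, X k z.1))
      (measurable_snd.prodMk ((hX k).comp measurable_fst))
  exact (Finset.measurable_fun_sum _ fun k _ => hk k).const_mul _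

theorem aestronglyMeasurable_empMean_h (hφ : IsDivergenceGenerator φ) (hθ : θ ∈ M.Θ)
    (hX : ∀ i, Measurable (X i)) (n : ℕ) (ω : Ω) :
    AEStronglyMeasurable (fun α => empMean X n ω (h φ M θ α))
      (volume.restrict (finiteSet φ M θ)) := by
  have h1 : Measurable fun α : Param d => empMean X n ω (hReg φ M θ α) :=
    (measurable_empMean_hReg (M := M) (θ := θ) hφ hX n).comp
      (f := fun α : Param d => (ω, α)) (measurable_const.prodMk measurable_id)
  refine h1.aestronglyMeasurable.congr ?_
  refine ae_restrict_of_forall_mem (measurableSet_finiteSet hφ hθ) fun α hα => ?_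
  simp only [h_eq_hReg hθ hα.1]

theorem aemeasurable_score (hX : ∀ i, Measurable (X i)) (hlaw : ∀ i, μ.map (X i) = M.law θ₀)
    (R3 : CondR3 φ M θ θ₀) (n : ℕ) (i : Fin d) :
    AEMeasurable (fun ω => score φ M θ θ₀ X n ω i) μ := by
  simp only [score, empMean]
  refine (Finset.aemeasurable_fun_sum _ fun k _ => ?_).const_mul _
  refine AEMeasurable.comp_measurable (g := fun x => gradH φ M θ θ₀ x i) ?_ (hX k)
  rw [hlaw k]
  exact (R3.memLp_grad i).1.aemeasurable

theorem aemeasurable_center (hX : ∀ i, Measurable (X i)) (hlaw : ∀ i, μ.map (X i) = M.law θ₀)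
    (R3 : CondR3 φ M θ θ₀) (n : ℕ) : AEMeasurable (center φ M θ θ₀ X n) μ := by
  have h1 : AEMeasurable (fun ω => score φ M θ θ₀ X n ω) μ :=
    aemeasurable_pi_lambda _ fun i => aemeasurable_score hX hlaw R3 n i
  have h2 : Measurable fun u : Fin d → ℝ =>
      θ₀ + (WithLp.toLp 2 ((matS φ M θ θ₀)⁻¹ *ᵥ u) : Param d) := by
    refine Continuous.measurable ?_
    exact continuous_const.add ((PiLp.continuous_toLp 2 _).comp
      (Continuous.matrix_mulVec continuous_const continuous_id))
  exact h2.comp_aemeasurable h1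

theorem measurable_lintegral_rescaled_sub {U : Set (Param d)} (hU : MeasurableSet U)
    {wt : Ω × Param d → ℝ} (hwtm : Measurable wt) {c : Ω → Param d} (hcm : Measurable c)
    {G : Param d → ℝ} (hG : Measurable G) (n : ℕ) :
    Measurable fun ω => ∫⁻ t : Param d, ‖(√(n : ℝ) ^ d)⁻¹ *
      (U.indicator (fun α => wt (ω, α)) ((√(n : ℝ))⁻¹ • t + c ω) / ∫ β in U, wt (ω, β))
        - G t‖ₑ := by
  have hwi : Measurable fun z : Ω × Param d => U.indicator (fun α => wt (z.1, α)) z.2 := by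
    have : (fun z : Ω × Param d => U.indicator (fun α => wt (z.1, α)) z.2) =
        (Prod.snd ⁻¹' U).indicator wt := by
      funext z
      by_cases hz : z.2 ∈ U
      · rw [indicator_of_mem hz, indicator_of_mem (show z ∈ Prod.snd ⁻¹' U from hz)]
      · rw [indicator_of_notMem hz, indicator_of_notMem (show z ∉ Prod.snd ⁻¹' U from hz)]
    rw [this]
    exact hwtm.indicator (measurable_snd hU)
  have hZ : Measurable fun ω => ∫ β in U, wt (ω, β) :=
    (StronglyMeasurable.integral_prod_right' hwtm.stronglyMeasurable).measurable
  refine Measurable.lintegral_prod_right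
    (f := fun (ω : Ω) (t : Param d) => ‖(√(n : ℝ) ^ d)⁻¹ *
    (U.indicator (fun α => wt (ω, α)) ((√(n : ℝ))⁻¹ • t + c ω) / ∫ β in U, wt (ω, β))
      - G t‖ₑ) ?_
  refine Measurable.enorm (Measurable.sub (Measurable.const_mul (Measurable.div ?_ ?_) _)
    (hG.comp measurable_snd))
  · have hm : Measurable fun z : Ω × Param d => (z.1, (√(n : ℝ))⁻¹ • z.2 + c z.1) := by fun_prop
    exact hwi.comp hm
  · exact hZ.comp measurable_fst

/-- The `L¹` distance of the rescaled posterior from a fixed function is a random variable. -/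
theorem aemeasurable_lintegral_rescaledPosterior_sub (hφ : IsDivergenceGenerator φ)
    (hθ : θ ∈ M.Θ) (hX : ∀ i, Measurable (X i))
    (hlaw : ∀ i, μ.map (X i) = M.law θ₀)
    (R3 : CondR3 φ M θ θ₀) (hprior : IntegrableOn prior M.Θ) {G : Param d → ℝ}
    (hG : Measurable G) {n : ℕ} (hn : n ≠ 0) :
    AEMeasurable (fun ω => ∫⁻ t, ‖rescaledPosterior φ M θ θ₀ prior X n ω t - G t‖ₑ) μ := by
  have hU := measurableSet_finiteSet (φ := φ) hφ hθ
  set U := finiteSet φ M θ with hUdef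
  have hpU : AEStronglyMeasurable prior (volume.restrict U) :=
    (hprior.mono_set finiteSet_subset).1
  -- The prior and the centre are only almost-everywhere measurable. Measurable versions `q` and `c`
  -- give a jointly measurable integrand, and the integral over `t` changes only for `ω` in a null
  -- set.
  set q := hpU.mk prior with hq
  have hqm : Measurable q := hpU.stronglyMeasurable_mk.measurable
  have hqe : ∀ᵐ α, α ∈ U → prior α = q α := (ae_restrict_iff' hU).1 hpU.ae_eq_mk
  set c := (aemeasurable_center hX hlaw R3 n).mk (center φ M θ θ₀ X n) with hc
  have hcm : Measurable c := (aemeasurable_center hX hlaw R3 n).measurable_mk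
  have hce : center φ M θ θ₀ X n =ᵐ[μ] c := (aemeasurable_center hX hlaw R3 n).ae_eq_mk
  set wt : Ω × Param d → ℝ := fun z =>
    Real.exp (n * empMean X n z.1 (hReg φ M θ z.2)) * q z.2 with hwt
  have hwtm : Measurable wt :=
    (Real.measurable_exp.comp ((measurable_empMean_hReg hφ hX n).const_mul _)).mul
      (hqm.comp measurable_snd)
  have hF := measurable_lintegral_rescaled_sub hU hwtm hcm hG n
  refine ⟨_, hF, ?_⟩
  filter_upwards [hce] with ω hω
  have hs : 0 < √(n : ℝ) := Real.sqrt_pos.2 (by positivity)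
  have hwe : ∀ᵐ α, α ∈ U → posteriorWeight φ M θ prior X n ω α = wt (ω, α) := by
    filter_upwards [hqe] with α hα hαU
    rw [posteriorWeight, hwt, hα hαU, h_eq_hReg hθ hαU.1]
  have hden : ∫ β in U, posteriorWeight φ M θ prior X n ω β = ∫ β in U, wt (ω, β) :=
    integral_congr_ae ((ae_restrict_iff' hU).2 hwe)
  refine lintegral_congr_ae ?_
  have := (quasiMeasurePreserving_smul_add hs (c ω)).ae hwe
  filter_upwards [this] with t ht
  rw [rescaledPosterior, posterior, hω, ← hUdef, hden]
  by_cases hm : (√(n : ℝ))⁻¹ • t + c ω ∈ U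
  · rw [indicator_of_mem hm, indicator_of_mem hm, ht hm]
  · rw [indicator_of_notMem hm, indicator_of_notMem hm]

/-- At `θ₀` the mean gradient of `h` vanishes, and `S` is positive definite. -/
theorem posDef_matS (hφ : IsDivergenceGenerator φ) (hθ : θ ∈ M.Θ) (hθ₀ : θ₀ ∈ M.Θ)
    (hint : ∀ α ∈ finiteSet φ M θ, Integrable (dualIntegrand φ M θ α) M.dom)
    (hh : ∀ α ∈ finiteSet φ M θ, Integrable (h φ M θ α) (M.law θ₀))
    (R2 : CondR2 φ M θ θ₀) (R3 : CondR3 φ M θ θ₀) :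
    (∀ i, ∫ x, gradH φ M θ θ₀ x i ∂(M.law θ₀) = 0) ∧ (matS φ M θ θ₀).PosDef := by
  obtain ⟨r, hr, hrU, H, hH, hae⟩ := R2.exists_taylorBound
  have h0 : θ₀ ∈ finiteSet φ M θ := by simpa using hrU 0 (by simpa using hr)
  have hT := abs_integral_taylor_le hθ₀ hr hrU hH (hae.mono fun x hx => hx.2) hh R3
  obtain ⟨hg, hq⟩ := hT.of_isMax hr fun v hv => integral_h_le hφ hθ h0 (hrU v hv) hint hh
  refine ⟨hg, posDef_of_quadForm_nonneg (fun i j => ?_) (fun v => ?_) R3.det_S_ne_zero⟩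
  · simp only [matS, Matrix.of_apply, neg_inj]
    exact integral_congr_ae (hae.mono fun x hx => hx.1 i j)
  · have := hq v
    rw [quadForm_neg] at this
    linarith

/-- Almost surely, the rescaled posterior converges to the Gaussian density along the sample sizes
at which the normalized score stays bounded. -/
theorem ae_tendsto_lintegral_rescaledPosterior_sub (hφ : IsDivergenceGenerator φ)
    (hθ : θ ∈ M.Θ) (hθ₀ : θ₀ ∈ M.Θ)
    (hint : ∀ α ∈ finiteSet φ M θ, Integrable (dualIntegrand φ M θ α) M.dom)
    (hsep : SeparatedFrom φ M θ θ₀) (hX : ∀ i, Measurable (X i))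
    (hindep : iIndepFun X μ) (hlaw : ∀ i, μ.map (X i) = M.law θ₀)
    (R1 : CondR1 φ M θ θ₀ μ X) (R2 : CondR2 φ M θ θ₀) (R3 : CondR3 φ M θ θ₀)
    (hprior_nonneg : ∀ α ∈ M.Θ, 0 ≤ prior α) (hprior_int : IntegrableOn prior M.Θ)
    (hprior_cont : ContinuousAt prior θ₀) (hprior_pos : 0 < prior θ₀) (b : ℝ) :
    ∀ᵐ ω ∂μ, Tendsto (fun n => ∫⁻ t, ‖rescaledPosterior φ M θ θ₀ prior X n ω t
      - gaussianDensity (matS φ M θ θ₀) t‖ₑ)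
      (atTop ⊓ 𝓟 {n : ℕ | ∀ i, √(n : ℝ) * |score φ M θ θ₀ X n ω i| ≤ b}) (𝓝 0) := by
  obtain ⟨r, hr, hrU, H, hH, hae⟩ := R2.exists_taylorBound
  have h0 : θ₀ ∈ finiteSet φ M θ := by simpa using hrU 0 (by simpa using hr)
  obtain ⟨-, hS⟩ := posDef_matS hφ hθ hθ₀ hint R1.integrable_h R2 R3
  have haeX : ∀ᵐ ω ∂μ, ∀ k, TaylorBound r θ₀ (fun α => h φ M θ α (X k ω))
      (gradH φ M θ θ₀ (X k ω)) (hessH φ M θ θ₀ (X k ω)) (H (X k ω)) := by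
    refine ae_all_iff.2 fun k => ?_
    refine ae_of_ae_map (hX k).aemeasurable (p := fun x => TaylorBound r θ₀
      (fun α => h φ M θ α x) (gradH φ M θ θ₀ x) (hessH φ M θ θ₀ x) (H x)) ?_
    rw [hlaw k]
    exact hae.mono fun x hx => hx.2
  have hhess : ∀ᵐ ω ∂μ, ∀ i j, Tendsto (fun n => empMean X n ω fun x => hessH φ M θ θ₀ x i j) atTop
      (𝓝 (-matS φ M θ θ₀ i j)) := by
    refine ae_all_iff.2 fun i => ae_all_iff.2 fun j => ?_
    have := tendsto_empMean hX hindep hlaw (R3.integrable_hess i j)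
    simpa [matS] using this
  filter_upwards [haeX, hhess, tendsto_empMean hX hindep hlaw hH, R1.tendsto_sup]
    with ω hTω hQω hKω hsupω
  -- The score of a fixed path need not stay bounded at the `√n` scale, so only sample sizes where
  -- it is below `b` are kept. This filter may be trivial; the convergence is then vacuous.
  set l : Filter ℕ := atTop ⊓ 𝓟 {n : ℕ | ∀ i, √(n : ℝ) * |score φ M θ θ₀ X n ω i| ≤ b} with hldef
  have hl : l ≤ atTop := inf_le_left
  set w : ℕ → Param d := fun n =>
    WithLp.toLp 2 ((matS φ M θ θ₀)⁻¹ *ᵥ score φ M θ θ₀ X n ω) with hwdef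
  have hw : ∀ᶠ n : ℕ in l, √(n : ℝ) * ‖w n‖ ≤ (∑ i, ∑ j, |(matS φ M θ θ₀)⁻¹ i j|) * b := by
    have hmem : ∀ᶠ n : ℕ in l, ∀ i, √(n : ℝ) * |score φ M θ θ₀ X n ω i| ≤ b :=
      mem_inf_of_right (mem_principal_self _)
    filter_upwards [hmem] with n hn
    have hs : 0 ≤ √(n : ℝ) := Real.sqrt_nonneg _
    have := norm_toLp_mulVec_le (matS φ M θ θ₀)⁻¹
      (u := √(n : ℝ) • score φ M θ θ₀ X n ω) (b := b) (fun i => by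
        simpa [abs_mul, abs_of_nonneg hs] using hn i)
    rwa [Matrix.mulVec_smul, WithLp.toLp_smul, norm_smul, Real.norm_of_nonneg hs] at this
  have hscore : ∀ n, matS φ M θ θ₀ *ᵥ (w n).ofLp = score φ M θ θ₀ X n ω := by
    intro n
    simp only [hwdef]
    rw [Matrix.mulVec_mulVec, Matrix.mul_nonsing_inv _ (isUnit_iff_ne_zero.2 R3.det_S_ne_zero),
      Matrix.one_mulVec]
  have hT : ∀ n, TaylorBound r θ₀ (fun α => empMean X n ω (h φ M θ α))
      (matS φ M θ θ₀ *ᵥ (w n).ofLp)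
      (Matrix.of fun i j => empMean X n ω fun x => hessH φ M θ θ₀ x i j) (empMean X n ω H) := by
    intro n
    rw [hscore]
    exact TaylorBound.empMean (f := fun α x => h φ M θ α x) hTω n
  have hsepl : ∀ δ : ℝ, 0 < δ → ∃ κ : ℝ, 0 < κ ∧ ∀ᶠ n : ℕ in l, ∀ α ∈ finiteSet φ M θ,
      δ ≤ ‖α - θ₀‖ → empMean X n ω (h φ M θ α) ≤ empMean X n ω (h φ M θ θ₀) - κ := by
    intro δ hδ
    obtain ⟨κ, hκ, hκle⟩ := exists_integral_h_le_sub hφ hθ h0 hint R1.integrable_h hsep hδ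
    -- Replacing population by empirical means at `α` and at `θ₀` costs at most `κ / 4` each.
    refine ⟨κ / 2, by positivity, hl ?_⟩
    have hev := hsupω.eventually
      (gt_mem_nhds (show (0 : ℝ≥0∞) < ENNReal.ofReal (κ / 4) by simpa using hκ))
    filter_upwards [hev] with n hn α hα hαδ
    have hdev : ∀ α ∈ finiteSet φ M θ,
        |empMean X n ω (h φ M θ α) - ∫ x, h φ M θ α x ∂(M.law θ₀)| < κ / 4 := by
      intro α hα
      have := (le_iSup₂ (f := fun α (_ : α ∈ finiteSet φ M θ) =>
        ‖empMean X n ω (h φ M θ α) - ∫ x, h φ M θ α x ∂(M.law θ₀)‖ₑ) α hα).trans_lt hn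
      rw [← ofReal_norm, ENNReal.ofReal_lt_ofReal_iff (by positivity)] at this
      exact this
    have h1 := abs_lt.1 (hdev α hα)
    have h2 := abs_lt.1 (hdev θ₀ h0)
    linarith [hκle α hα hαδ, h1.2, h2.1]
  have hU := measurableSet_finiteSet (φ := φ) hφ hθ
  have hfinal := tendsto_lintegral_rescaled_sub_gaussian hl hS hU
    (fun α hα => hprior_nonneg α hα.1) (hprior_int.mono_set finiteSet_subset) hprior_cont
    hprior_pos hr hrU (fun n => aestronglyMeasurable_empMean_h hφ hθ hX n ω) hw hT
    (fun i j => (hQω i j).mono_left hl) (hKω.mono_left hl) hsepl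
  exact hfinal

/-- Dominated convergence for the indicators, the constant `1` being integrable under a finite
measure. -/
theorem tendsto_measure_of_ae_eventually_notMem [IsFiniteMeasure μ] {A : ℕ → Set Ω}
    (hA : ∀ᶠ n in atTop, NullMeasurableSet (A n) μ) (h : ∀ᵐ ω ∂μ, ∀ᶠ n in atTop, ω ∉ A n) :
    Tendsto (fun n => μ (A n)) atTop (𝓝 0) := by
  have := tendsto_lintegral_filter_of_dominated_convergence' (μ := μ) (l := atTop)
    (F := fun n => (A n).indicator (1 : Ω → ℝ≥0∞)) (f := fun _ => 0) (fun _ => 1)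
    (hA.mono fun n hn => (aemeasurable_indicator_const_iff 1).2 hn)
    (Eventually.of_forall fun n => ae_of_all _ fun ω => indicator_le_self' (by simp) ω)
    (by simp) ?_
  · rw [lintegral_zero] at this
    refine this.congr' ?_
    filter_upwards [hA] with n hn
    exact lintegral_indicator_one₀ hn
  · filter_upwards [h] with ω hω
    refine tendsto_const_nhds.congr' ?_
    filter_upwards [hω] with n hn
    rw [indicator_of_notMem hn]

end Posterior

end PhiPosterior

end

/-! ### From almost sure convergence to convergence in probability. -/

theorem theorem1 {d : ℕ} {𝒳 : Type*} [MeasurableSpace 𝒳]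
    (M : PhiPosterior.Model d 𝒳)
    (φ : ℝ → ℝ) (hφ : PhiPosterior.IsDivergenceGenerator φ)
    (θ θ₀ : PhiPosterior.Param d) (hθ : θ ∈ M.Θ) (hθ₀ : θ₀ ∈ M.Θ)
    (hint : ∀ α ∈ PhiPosterior.finiteSet φ M θ,
      Integrable (PhiPosterior.dualIntegrand φ M θ α) M.dom)
    (hsep : PhiPosterior.SeparatedFrom φ M θ θ₀)
    {Ω : Type*} [MeasurableSpace Ω] (μ : Measure Ω) [IsProbabilityMeasure μ]
    (X : ℕ → Ω → 𝒳) (hX : ∀ i, Measurable (X i))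
    (hindep : iIndepFun X μ) (hlaw : ∀ i, μ.map (X i) = M.law θ₀)
    (R1 : PhiPosterior.CondR1 φ M θ θ₀ μ X)
    (R2 : PhiPosterior.CondR2 φ M θ θ₀)
    (R3 : PhiPosterior.CondR3 φ M θ θ₀)
    (R4 : PhiPosterior.CondR4 φ M θ θ₀ μ X)
    (prior : PhiPosterior.Param d → ℝ)
    (hprior_nonneg : ∀ α ∈ M.Θ, 0 ≤ prior α)
    (hprior_int : IntegrableOn prior M.Θ)
    (hprior_moment : IntegrableOn (fun α => ‖α‖ * prior α) M.Θ)
    (hprior_cont : ContinuousAt prior θ₀)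
    (hprior_pos : 0 < prior θ₀) :
    ∀ ε : ℝ, 0 < ε →
      Tendsto (fun n : ℕ => μ {ω | ENNReal.ofReal ε ≤
        ∫⁻ t, ‖PhiPosterior.rescaledPosterior φ M θ θ₀ prior X n ω t
          - PhiPosterior.gaussianDensity (PhiPosterior.matS φ M θ θ₀) t‖ₑ}) atTop (𝓝 0) := by
  intro ε hε
  set F : ℕ → Ω → ℝ≥0∞ := fun n ω =>
    ∫⁻ t, ‖PhiPosterior.rescaledPosterior φ M θ θ₀ prior X n ω t
      - PhiPosterior.gaussianDensity (PhiPosterior.matS φ M θ θ₀) t‖ₑ with hF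
  have hgauss : Measurable (PhiPosterior.gaussianDensity (PhiPosterior.matS φ M θ θ₀)) :=
    (((PhiPosterior.continuous_quadForm _).const_mul _).rexp.const_mul _).measurable
  have hmean := (PhiPosterior.posDef_matS hφ hθ hθ₀ hint R1.integrable_h R2 R3).1
  rw [ENNReal.tendsto_nhds_zero]
  intro η hη
  -- The Chebyshev bounds do not involve `n`, so one truncation level `b` makes the bad event `(T
  -- n)ᶜ` have probability at most `η / 2` for every positive `n`.
  have hvar : Tendsto (fun b : ℝ => ∑ i, ENNReal.ofReal
      (variance (fun x => PhiPosterior.gradH φ M θ θ₀ x i) (M.law θ₀) / b ^ 2)) atTop (𝓝 0) := by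
    have : Tendsto (fun b : ℝ => ∑ i : Fin d, ENNReal.ofReal
        (variance (fun x => PhiPosterior.gradH φ M θ θ₀ x i) (M.law θ₀) / b ^ 2)) atTop
        (𝓝 (∑ _i : Fin d, ENNReal.ofReal 0)) :=
      tendsto_finsetSum _ fun i _ => ENNReal.tendsto_ofReal
        ((tendsto_const_nhds (x := variance (fun x => PhiPosterior.gradH φ M θ θ₀ x i)
          (M.law θ₀))).div_atTop (tendsto_pow_atTop two_ne_zero))
    simpa using this
  have hη2 : 0 < η / 2 := ENNReal.half_pos hη.ne'
  obtain ⟨b, hbη, hb⟩ := ((ENNReal.tendsto_nhds_zero.1 hvar (η / 2) hη2).and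
    (eventually_gt_atTop 0)).exists
  set T : ℕ → Set Ω := fun n =>
    {ω | ∀ i, √(n : ℝ) * |PhiPosterior.score φ M θ θ₀ X n ω i| ≤ b} with hT
  -- Almost every path lies in only finitely many of these events, because `F n ω` tends to `0`
  -- along the `n` with `ω ∈ T n`.
  have hgood : Tendsto (fun n => μ ({ω | ENNReal.ofReal ε ≤ F n ω} ∩ T n)) atTop (𝓝 0) := by
    refine PhiPosterior.tendsto_measure_of_ae_eventually_notMem ?_ ?_
    · filter_upwards [eventually_ne_atTop 0] with n hn
      refine NullMeasurableSet.inter ?_ ?_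
      · exact nullMeasurableSet_le aemeasurable_const
          (PhiPosterior.aemeasurable_lintegral_rescaledPosterior_sub hφ hθ hX hlaw R3 hprior_int
            hgauss hn)
      · rw [hT]
        simp only [ofPred_forall]
        refine NullMeasurableSet.iInter fun i => nullMeasurableSet_le ?_ aemeasurable_const
        exact ((continuous_abs.measurable.comp_aemeasurable
          (PhiPosterior.aemeasurable_score hX hlaw R3 n i))).const_mul _
    · filter_upwards [PhiPosterior.ae_tendsto_lintegral_rescaledPosterior_sub hφ hθ hθ₀ hint hsep hX
        hindep hlaw R1 R2 R3 hprior_nonneg hprior_int hprior_cont hprior_pos b] with ω hω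
      have := hω.eventually (gt_mem_nhds (ENNReal.ofReal_pos.2 hε))
      rw [eventually_inf_principal] at this
      filter_upwards [this] with n hn hmem
      exact absurd (hn hmem.2) (not_lt.2 hmem.1)
  filter_upwards [ENNReal.tendsto_nhds_zero.1 hgood (η / 2) hη2, eventually_ne_atTop 0]
    with n hn hn0
  have hcompl : μ (T n)ᶜ ≤ η / 2 := by
    refine le_trans ?_ hbη
    have hsub : (T n)ᶜ ⊆ ⋃ i, {ω | b ≤ √(n : ℝ) *
        |PhiPosterior.empMean X n ω fun x => PhiPosterior.gradH φ M θ θ₀ x i|} := by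
      intro ω hω
      simp only [hT, mem_compl_iff, mem_ofPred_eq, not_forall, not_le] at hω
      obtain ⟨i, hi⟩ := hω
      exact mem_iUnion.2 ⟨i, hi.le⟩
    refine (measure_mono hsub).trans ((measure_iUnion_fintype_le _ _).trans ?_)
    exact Finset.sum_le_sum fun i _ => PhiPosterior.measure_le_sqrt_mul_abs_empMean hX hindep hlaw
      (R3.memLp_grad i) (hmean i) hb hn0
  calc μ {ω | ENNReal.ofReal ε ≤ F n ω}
      ≤ μ (({ω | ENNReal.ofReal ε ≤ F n ω} ∩ T n) ∪ (T n)ᶜ) := by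
        refine measure_mono fun ω hω => ?_
        by_cases hωT : ω ∈ T n
        · exact Or.inl ⟨hω, hωT⟩
        · exact Or.inr hωT
    _ ≤ η / 2 + η / 2 := (measure_union_le _ _).trans (add_le_add hn hcompl)
    _ = η := ENNReal.add_halves η
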